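/- **Theorem.** Let $K$ be a field and let $H$ be a Hopf algebra over $K$ with multiplication $m$, comultiplication $\Delta(h)=h_1\otimes h_2$, counit $\varepsilon$ and antipode $S$. Assume that: 1. $H$ has an *ad-coinvariant integral*, i.e. there is $t\in H$ with $ht=\varepsilon(h)t$ for all $h\in H$, with $t_1S(t_3)\otimes t_2=1_H\otimes t$, and with $\varepsilon(t)=1_K$; 2. $H$ is *formally smooth* as a $K$-coalgebra, i.e. the $H$-bicomodule $\operatorname{Coker}(\Delta\colon H\to H\otimes H)$ (a quotient of $H\otimes H$ with the coactions $\Delta\otimes H$ and $H\otimes\Delta$) is injective relative to the homomorphisms of $H$-bicomodules that have a $K$-linear retraction: for every such homomorphism $i\colon X\to Y$, every homomorphism of $H$-bicomodules $X\to\operatorname{Coker}\Delta$ is the composite of $i$ with a homomorphism of $H$-bicomodules $Y\to\operatorname{Coker}\Delta$. Let $\mathcal M$ be either the monoidal category $\mathfrak M_H$ of right $H$-modules or the monoidal category ${}_H\mathfrak M_H$ of $H$-bimodules, in both cases with $\otimes=\otimes_K$ carrying the diagonal action(s) and with unit $K$, on which $H$ acts through $\varepsilon$. A *coalgebra in $\mathcal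 M$* is a $K$-coalgebra $E$ which is also an object of $\mathcal M$ such that $\Delta_E\colon E\to E\otimes E$ and $\varepsilon_E\colon E\to K$ are morphisms in $\mathcal M$; $H$ is one through $m$ and $\Delta$. Suppose that $H$ is a subcoalgebra in $\mathcal M$ of a coalgebra $E$ in $\mathcal M$, and that $\operatorname{Corad}(E)\subseteq H$, where $\operatorname{Corad}(E)$ is the sum of all simple subcoalgebras of the $K$-coalgebra $E$. Then there exists a coalgebra homomorphism $\pi\colon E\to H$ in $\mathcal M$ with $\pi|_H=\mathrm{Id}_H$; that is, $\pi$ is a $K$-coalgebra homomorphism which is right $H$-linear if $\mathcal M=\mathfrak M_H$, and left and right $H$-linear if $\mathcal M={}_H\mathfrak M_H$. -/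

import Mathlib

open scoped TensorProduct

universe u v w

noncomputable section

namespace HopfSplitting

/-! ### Bicomodules and formal smoothness of a coalgebra over a field -/

/-- A `C`-bicomodule over the coalgebra `C`: a vector space `M` with a left coaction
`M → C ⊗ M` and a right coaction `M → M ⊗ C`, each coassociative and counital, that commute. -/
class Bicomodule (K : Type u) (C : Type v) (M : Type w) [Field K]
    [AddCommGroup C] [Module K C] [Coalgebra K C] [AddCommGroup M] [Module K M] where
  /-- the left coaction -/
  coactL : M →ₗ[K] C ⊗[K] M
  /-- the right coaction -/
  coactR : M →ₗ[K] M ⊗[K] C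
  coassocL : (TensorProduct.assoc K C C M).toLinearMap ∘ₗ
      LinearMap.rTensor M (Coalgebra.comul (R := K) (A := C)) ∘ₗ coactL
    = LinearMap.lTensor C coactL ∘ₗ coactL
  counitL : (TensorProduct.lid K M).toLinearMap ∘ₗ
      LinearMap.rTensor M (Coalgebra.counit (R := K) (A := C)) ∘ₗ coactL = LinearMap.id
  coassocR : (TensorProduct.assoc K M C C).toLinearMap ∘ₗ LinearMap.rTensor C coactR ∘ₗ coactR
    = LinearMap.lTensor M (Coalgebra.comul (R := K) (A := C)) ∘ₗ coactR
  counitR : (TensorProduct.rid K M).toLinearMap ∘ₗ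
      LinearMap.lTensor M (Coalgebra.counit (R := K) (A := C)) ∘ₗ coactR = LinearMap.id
  compat : (TensorProduct.assoc K C M C).toLinearMap ∘ₗ LinearMap.rTensor C coactL ∘ₗ coactR
    = LinearMap.lTensor C coactR ∘ₗ coactL

section Coalgebras

variable (K : Type u) (C : Type v) [Field K] [AddCommGroup C] [Module K C] [Coalgebra K C]

/-- The left coaction of a bicomodule. -/
abbrev coactL (M : Type w) [AddCommGroup M] [Module K M] [B : Bicomodule K C M] :
    M →ₗ[K] C ⊗[K] M := B.coactL

/-- The right coaction of a bicomodule. -/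
abbrev coactR (M : Type w) [AddCommGroup M] [Module K M] [B : Bicomodule K C M] :
    M →ₗ[K] M ⊗[K] C := B.coactR

/-- A linear map of `C`-bicomodules is bicolinear if it commutes with both coactions. -/
def IsBicolinear {X Y : Type v} [AddCommGroup X] [Module K X] [Bicomodule K C X]
    [AddCommGroup Y] [Module K Y] [Bicomodule K C Y] (f : X →ₗ[K] Y) : Prop :=
  coactL K C Y ∘ₗ f = LinearMap.lTensor C f ∘ₗ coactL K C X ∧
  coactR K C Y ∘ₗ f = LinearMap.rTensor C f ∘ₗ coactR K C X

/-- A `C`-bicomodule `I` is injective relative to the bicomodule maps that have a retraction in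
the category of vector spaces: for every bicolinear `i : X → Y` with a `K`-linear retraction,
every bicolinear `f : X → I` factors through `i` by a bicolinear map `Y → I`. -/
def IsRelInjective (I : Type v) [AddCommGroup I] [Module K I] [Bicomodule K C I] : Prop :=
  ∀ (X Y : Type v) [AddCommGroup X] [Module K X] [Bicomodule K C X]
    [AddCommGroup Y] [Module K Y] [Bicomodule K C Y]
    (i : X →ₗ[K] Y) (f : X →ₗ[K] I), IsBicolinear K C i → IsBicolinear K C f →
    (∃ r : Y →ₗ[K] X, r ∘ₗ i = LinearMap.id) →
    ∃ g : Y →ₗ[K] I, IsBicolinear K C g ∧ g ∘ₗ i = f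

/-- `C ⊗ C` is a bicomodule through `Δ ⊗ C` and `C ⊗ Δ`. -/
instance tensorBicomodule : Bicomodule K C (C ⊗[K] C) where
  coactL := (TensorProduct.assoc K C C C).toLinearMap ∘ₗ
    LinearMap.rTensor C (Coalgebra.comul (R := K) (A := C))
  coactR := (TensorProduct.assoc K C C C).symm.toLinearMap ∘ₗ
    LinearMap.lTensor C (Coalgebra.comul (R := K) (A := C))
  coassocL := by
    ext x y
    have key : ∀ z : C ⊗[K] C,
        TensorProduct.assoc K C C (C ⊗[K] C) (LinearMap.rTensor (C ⊗[K] C) Coalgebra.comul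
          (TensorProduct.assoc K C C C (z ⊗ₜ[K] y)))
        = LinearMap.lTensor C (TensorProduct.assoc K C C C).toLinearMap
          (TensorProduct.assoc K C (C ⊗[K] C) C
            ((TensorProduct.assoc K C C C (LinearMap.rTensor C Coalgebra.comul z)) ⊗ₜ[K] y)) := by
      intro z
      induction z with
      | zero => simp
      | add a b ha hb => simp only [TensorProduct.add_tmul, map_add, ha, hb]
      | tmul a b =>
        simp only [TensorProduct.assoc_tmul, LinearMap.rTensor_tmul]
        generalize (Coalgebra.comul (R := K) a) = w
        induction w with
        | zero => simp
        | add a b ha hb => simp only [TensorProduct.add_tmul, map_add, ha, hb]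
        | tmul c d => simp
    have key2 : ∀ z : C ⊗[K] C,
        LinearMap.lTensor C ((TensorProduct.assoc K C C C).toLinearMap ∘ₗ
          LinearMap.rTensor C Coalgebra.comul) (TensorProduct.assoc K C C C (z ⊗ₜ[K] y))
        = LinearMap.lTensor C (TensorProduct.assoc K C C C).toLinearMap
          (TensorProduct.assoc K C (C ⊗[K] C) C
            ((LinearMap.lTensor C Coalgebra.comul z) ⊗ₜ[K] y)) := by
      intro z
      induction z with
      | zero => simp
      | add a b ha hb => simp only [TensorProduct.add_tmul, map_add, ha, hb]
      | tmul a b => simp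
    have h := Coalgebra.coassoc_apply (R := K) x
    simp only [TensorProduct.AlgebraTensorModule.curry_apply, TensorProduct.curry_apply,
      LinearMap.coe_restrictScalars, LinearMap.coe_comp, Function.comp_apply,
      LinearEquiv.coe_coe, LinearMap.rTensor_tmul]
    rw [key, key2, h]
  counitL := by
    ext x y
    have key : ∀ z : C ⊗[K] C,
        TensorProduct.lid K (C ⊗[K] C) (LinearMap.rTensor (C ⊗[K] C) Coalgebra.counit
          (TensorProduct.assoc K C C C (z ⊗ₜ[K] y)))
        = (TensorProduct.lid K C (LinearMap.rTensor C Coalgebra.counit z)) ⊗ₜ[K] y := by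
      intro z
      induction z with
      | zero => simp
      | add a b ha hb => simp only [TensorProduct.add_tmul, map_add, ha, hb]
      | tmul a b => simp [TensorProduct.smul_tmul']
    simp [key]
  coassocR := by
    ext x y
    have key : ∀ z : C ⊗[K] C,
        TensorProduct.assoc K (C ⊗[K] C) C C (LinearMap.rTensor C
          ((TensorProduct.assoc K C C C).symm.toLinearMap ∘ₗ LinearMap.lTensor C Coalgebra.comul)
          ((TensorProduct.assoc K C C C).symm (x ⊗ₜ[K] z)))
        = (TensorProduct.assoc K C C (C ⊗[K] C)).symm (x ⊗ₜ[K]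
            (TensorProduct.assoc K C C C (LinearMap.rTensor C Coalgebra.comul z))) := by
      intro z
      induction z with
      | zero => simp
      | add a b ha hb => simp only [TensorProduct.tmul_add, map_add, ha, hb]
      | tmul a b =>
        simp only [TensorProduct.assoc_symm_tmul, LinearMap.rTensor_tmul, LinearMap.coe_comp,
          Function.comp_apply, LinearEquiv.coe_coe, LinearMap.lTensor_tmul]
        generalize (Coalgebra.comul (R := K) a) = w
        induction w with
        | zero => simp
        | add a b ha hb =>
          simp only [TensorProduct.add_tmul, TensorProduct.tmul_add, map_add, ha, hb]
        | tmul c d => simp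
    have key2 : ∀ z : C ⊗[K] C,
        LinearMap.lTensor (C ⊗[K] C) Coalgebra.comul
          ((TensorProduct.assoc K C C C).symm (x ⊗ₜ[K] z))
        = (TensorProduct.assoc K C C (C ⊗[K] C)).symm (x ⊗ₜ[K]
            (LinearMap.lTensor C Coalgebra.comul z)) := by
      intro z
      induction z with
      | zero => simp
      | add a b ha hb => simp only [TensorProduct.tmul_add, map_add, ha, hb]
      | tmul a b => simp
    have h := Coalgebra.coassoc_apply (R := K) y
    simp only [TensorProduct.AlgebraTensorModule.curry_apply, TensorProduct.curry_apply,
      LinearMap.coe_restrictScalars, LinearMap.coe_comp, Function.comp_apply,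
      LinearEquiv.coe_coe, LinearMap.lTensor_tmul] at key ⊢
    rw [key, key2, h]
  counitR := by
    ext x y
    have key : ∀ z : C ⊗[K] C,
        TensorProduct.rid K (C ⊗[K] C) (LinearMap.lTensor (C ⊗[K] C) Coalgebra.counit
          ((TensorProduct.assoc K C C C).symm (x ⊗ₜ[K] z)))
        = x ⊗ₜ[K] (TensorProduct.rid K C (LinearMap.lTensor C Coalgebra.counit z)) := by
      intro z
      induction z with
      | zero => simp
      | add a b ha hb => simp only [TensorProduct.tmul_add, map_add, ha, hb]
      | tmul a b => simp
    simp [key]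
  compat := by
    ext x y
    have key : ∀ z w : C ⊗[K] C,
        TensorProduct.assoc K C (C ⊗[K] C) C ((TensorProduct.assoc K C C C).toLinearMap.rTensor C
          ((TensorProduct.assoc K (C ⊗[K] C) C C).symm (z ⊗ₜ[K] w)))
        = LinearMap.lTensor C (TensorProduct.assoc K C C C).symm.toLinearMap
          (TensorProduct.assoc K C C (C ⊗[K] C) (z ⊗ₜ[K] w)) := by
      intro z w
      induction z with
      | zero => simp
      | add a b ha hb => simp only [TensorProduct.add_tmul, map_add, ha, hb]
      | tmul a b =>
        induction w with
        | zero => simp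
        | add a b ha hb => simp only [TensorProduct.tmul_add, map_add, ha, hb]
        | tmul c d => simp
    have key2 : ∀ w : C ⊗[K] C,
        LinearMap.rTensor C ((TensorProduct.assoc K C C C).toLinearMap ∘ₗ
          LinearMap.rTensor C Coalgebra.comul) ((TensorProduct.assoc K C C C).symm (x ⊗ₜ[K] w))
        = (TensorProduct.assoc K C C C).toLinearMap.rTensor C
          ((TensorProduct.assoc K (C ⊗[K] C) C C).symm (Coalgebra.comul x ⊗ₜ[K] w)) := by
      intro w
      induction w with
      | zero => simp
      | add a b ha hb => simp only [TensorProduct.tmul_add, map_add, ha, hb]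
      | tmul c d => simp
    have key3 : ∀ z : C ⊗[K] C,
        LinearMap.lTensor C ((TensorProduct.assoc K C C C).symm.toLinearMap ∘ₗ
          LinearMap.lTensor C Coalgebra.comul) (TensorProduct.assoc K C C C (z ⊗ₜ[K] y))
        = LinearMap.lTensor C (TensorProduct.assoc K C C C).symm.toLinearMap
          (TensorProduct.assoc K C C (C ⊗[K] C) (z ⊗ₜ[K] Coalgebra.comul y)) := by
      intro z
      induction z with
      | zero => simp
      | add a b ha hb => simp only [TensorProduct.add_tmul, map_add, ha, hb]
      | tmul c d => simp
    simp only [TensorProduct.AlgebraTensorModule.curry_apply, TensorProduct.curry_apply,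
      LinearMap.coe_restrictScalars, LinearMap.coe_comp, Function.comp_apply,
      LinearEquiv.coe_coe, LinearMap.lTensor_tmul, LinearMap.rTensor_tmul] at key2 key3 ⊢
    rw [key2, key3, key]

/-- The bicomodule structure on the quotient `M ⧸ N` of a bicomodule by a subspace on which both
coactions vanish modulo `N`. -/
@[reducible] def quotientBicomodule (M : Type w) [AddCommGroup M] [Module K M] [Bicomodule K C M]
    (N : Submodule K M)
    (hL : N ≤ LinearMap.ker (LinearMap.lTensor C N.mkQ ∘ₗ coactL K C M))
    (hR : N ≤ LinearMap.ker (LinearMap.rTensor C N.mkQ ∘ₗ coactR K C M)) :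
    Bicomodule K C (M ⧸ N) where
  coactL := N.liftQ (LinearMap.lTensor C N.mkQ ∘ₗ coactL K C M) hL
  coactR := N.liftQ (LinearMap.rTensor C N.mkQ ∘ₗ coactR K C M) hR
  coassocL := by
    apply Submodule.linearMap_qext
    ext m
    have key : ∀ z : C ⊗[K] M,
        TensorProduct.assoc K C C (M ⧸ N) (LinearMap.rTensor (M ⧸ N) Coalgebra.comul
          (LinearMap.lTensor C N.mkQ z))
        = LinearMap.lTensor C (LinearMap.lTensor C N.mkQ) (TensorProduct.assoc K C C M
          (LinearMap.rTensor M Coalgebra.comul z)) := by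
      intro z
      induction z with
      | zero => simp
      | add a b ha hb => simp only [map_add, ha, hb]
      | tmul c x =>
        simp only [LinearMap.lTensor_tmul, LinearMap.rTensor_tmul]
        generalize (Coalgebra.comul (R := K) c) = w
        induction w with
        | zero => simp
        | add a b ha hb => simp only [TensorProduct.add_tmul, map_add, ha, hb]
        | tmul c d => simp
    have h : TensorProduct.assoc K C C M (LinearMap.rTensor M Coalgebra.comul (coactL K C M m))
        = LinearMap.lTensor C (coactL K C M) (coactL K C M m) :=
      LinearMap.congr_fun (Bicomodule.coassocL (K := K) (C := C) (M := M)) m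
    simp only [LinearMap.coe_comp, Function.comp_apply, LinearEquiv.coe_coe,
      Submodule.mkQ_apply, Submodule.liftQ_apply]
    rw [key, h]
    simp only [← LinearMap.lTensor_comp_apply, Submodule.liftQ_mkQ]
  counitL := by
    apply Submodule.linearMap_qext
    ext m
    have key : ∀ z : C ⊗[K] M,
        TensorProduct.lid K (M ⧸ N) (LinearMap.rTensor (M ⧸ N) Coalgebra.counit
          (LinearMap.lTensor C N.mkQ z))
        = N.mkQ (TensorProduct.lid K M (LinearMap.rTensor M Coalgebra.counit z)) := by
      intro z
      induction z with
      | zero => simp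
      | add a b ha hb => simp only [map_add, ha, hb]
      | tmul c x => simp
    have h : TensorProduct.lid K M (LinearMap.rTensor M Coalgebra.counit (coactL K C M m)) = m :=
      LinearMap.congr_fun (Bicomodule.counitL (K := K) (C := C) (M := M)) m
    simp only [LinearMap.coe_comp, Function.comp_apply, LinearEquiv.coe_coe,
      Submodule.mkQ_apply, Submodule.liftQ_apply, LinearMap.id_coe, id_eq]
    rw [key, h, Submodule.mkQ_apply]
  coassocR := by
    apply Submodule.linearMap_qext
    ext m
    have key : ∀ z : M ⊗[K] C,
        LinearMap.lTensor (M ⧸ N) (Coalgebra.comul (R := K)) (LinearMap.rTensor C N.mkQ z)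
        = LinearMap.rTensor (C ⊗[K] C) N.mkQ (LinearMap.lTensor M Coalgebra.comul z) := by
      intro z
      induction z with
      | zero => simp
      | add a b ha hb => simp only [map_add, ha, hb]
      | tmul c x => simp
    have key2 : ∀ z : (M ⊗[K] C) ⊗[K] C,
        TensorProduct.assoc K (M ⧸ N) C C
          (LinearMap.rTensor C (LinearMap.rTensor C N.mkQ) z)
        = LinearMap.rTensor (C ⊗[K] C) N.mkQ (TensorProduct.assoc K M C C z) := by
      intro z
      induction z with
      | zero => simp
      | add a b ha hb => simp only [map_add, ha, hb]
      | tmul z d =>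
        induction z with
        | zero => simp
        | add a b ha hb => simp only [TensorProduct.add_tmul, map_add, ha, hb]
        | tmul c x => simp
    have h : TensorProduct.assoc K M C C (LinearMap.rTensor C (coactR K C M) (coactR K C M m))
        = LinearMap.lTensor M Coalgebra.comul (coactR K C M m) :=
      LinearMap.congr_fun (Bicomodule.coassocR (K := K) (C := C) (M := M)) m
    simp only [LinearMap.coe_comp, Function.comp_apply, LinearEquiv.coe_coe,
      Submodule.mkQ_apply, Submodule.liftQ_apply]
    rw [key, ← h, ← key2]
    simp only [← LinearMap.rTensor_comp_apply, Submodule.liftQ_mkQ]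
  counitR := by
    apply Submodule.linearMap_qext
    ext m
    have key : ∀ z : M ⊗[K] C,
        TensorProduct.rid K (M ⧸ N) (LinearMap.lTensor (M ⧸ N) Coalgebra.counit
          (LinearMap.rTensor C N.mkQ z))
        = N.mkQ (TensorProduct.rid K M (LinearMap.lTensor M Coalgebra.counit z)) := by
      intro z
      induction z with
      | zero => simp
      | add a b ha hb => simp only [map_add, ha, hb]
      | tmul c x => simp
    have h : TensorProduct.rid K M (LinearMap.lTensor M Coalgebra.counit (coactR K C M m)) = m :=
      LinearMap.congr_fun (Bicomodule.counitR (K := K) (C := C) (M := M)) m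
    simp only [LinearMap.coe_comp, Function.comp_apply, LinearEquiv.coe_coe,
      Submodule.mkQ_apply, Submodule.liftQ_apply, LinearMap.id_coe, id_eq]
    rw [key, h, Submodule.mkQ_apply]
  compat := by
    apply Submodule.linearMap_qext
    ext m
    have key : ∀ z : (C ⊗[K] M) ⊗[K] C,
        TensorProduct.assoc K C (M ⧸ N) C
          (LinearMap.rTensor C (LinearMap.lTensor C N.mkQ) z)
        = LinearMap.lTensor C (LinearMap.rTensor C N.mkQ) (TensorProduct.assoc K C M C z) := by
      intro z
      induction z with
      | zero => simp
      | add a b ha hb => simp only [map_add, ha, hb]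
      | tmul z d =>
        induction z with
        | zero => simp
        | add a b ha hb => simp only [TensorProduct.add_tmul, map_add, ha, hb]
        | tmul c x => simp
    have h : TensorProduct.assoc K C M C (LinearMap.rTensor C (coactL K C M) (coactR K C M m))
        = LinearMap.lTensor C (coactR K C M) (coactL K C M m) :=
      LinearMap.congr_fun (Bicomodule.compat (K := K) (C := C) (M := M)) m
    have e1 : LinearMap.rTensor C (N.liftQ (LinearMap.lTensor C N.mkQ ∘ₗ coactL K C M) hL)
          (LinearMap.rTensor C N.mkQ (coactR K C M m))
        = LinearMap.rTensor C (LinearMap.lTensor C N.mkQ)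
          (LinearMap.rTensor C (coactL K C M) (coactR K C M m)) := by
      simp only [← LinearMap.rTensor_comp_apply, Submodule.liftQ_mkQ]
    have e2 : LinearMap.lTensor C (N.liftQ (LinearMap.rTensor C N.mkQ ∘ₗ coactR K C M) hR)
          (LinearMap.lTensor C N.mkQ (coactL K C M m))
        = LinearMap.lTensor C (LinearMap.rTensor C N.mkQ)
          (LinearMap.lTensor C (coactR K C M) (coactL K C M m)) := by
      simp only [← LinearMap.lTensor_comp_apply, Submodule.liftQ_mkQ]
    simp only [LinearMap.coe_comp, Function.comp_apply, LinearEquiv.coe_coe,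
      Submodule.mkQ_apply, Submodule.liftQ_apply]
    rw [e1, e2, key, h]

/-- The cokernel of the comultiplication `Δ : C → C ⊗ C`. -/
abbrev CokerComul : Type v :=
  (C ⊗[K] C) ⧸ LinearMap.range (Coalgebra.comul (R := K) (A := C))

/-- The bicomodule structure on `Coker Δ` induced by that of `C ⊗ C`. -/
instance cokerComulBicomodule : Bicomodule K C (CokerComul K C) :=
  quotientBicomodule K C (C ⊗[K] C) (LinearMap.range (Coalgebra.comul (R := K) (A := C)))
    (by
      rintro _ ⟨c, rfl⟩
      have h : coactL K C (C ⊗[K] C) (Coalgebra.comul c) = LinearMap.lTensor C Coalgebra.comul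
          (Coalgebra.comul (R := K) c) := Coalgebra.coassoc_apply c
      rw [LinearMap.mem_ker, LinearMap.comp_apply, h, ← LinearMap.comp_apply,
        ← LinearMap.lTensor_comp, LinearMap.range_mkQ_comp, LinearMap.lTensor_zero,
        LinearMap.zero_apply])
    (by
      rintro _ ⟨c, rfl⟩
      have h : coactR K C (C ⊗[K] C) (Coalgebra.comul c) = LinearMap.rTensor C Coalgebra.comul
          (Coalgebra.comul (R := K) c) := Coalgebra.coassoc_symm_apply c
      rw [LinearMap.mem_ker, LinearMap.comp_apply, h, ← LinearMap.comp_apply,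
        ← LinearMap.rTensor_comp, LinearMap.range_mkQ_comp, LinearMap.rTensor_zero,
        LinearMap.zero_apply])

/-- `C` is formally smooth as a coalgebra in the monoidal category of `K`-vector spaces. -/
def IsFormallySmooth : Prop := IsRelInjective K C (CokerComul K C)

/-! ### The coradical -/

/-- The subspace `D` is a subcoalgebra: `Δ(D) ⊆ D ⊗ D`. -/
def IsSubcoalgebra (D : Submodule K C) : Prop :=
  ∀ x ∈ D, Coalgebra.comul (R := K) x ∈ LinearMap.range (TensorProduct.map D.subtype D.subtype)

/-- A subcoalgebra is simple if it is nonzero and has no subcoalgebras besides `0` and itself. -/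
def IsSimpleSubcoalgebra (D : Submodule K C) : Prop :=
  IsSubcoalgebra K C D ∧ D ≠ ⊥ ∧ ∀ D' ≤ D, IsSubcoalgebra K C D' → D' = ⊥ ∨ D' = D

/-- The coradical: the sum of all simple subcoalgebras. -/
def coradical : Submodule K C := sSup {D | IsSimpleSubcoalgebra K C D}

end Coalgebras

/-! ### Ad-coinvariant integrals and coalgebras in categories of modules -/

section Hopf

variable (K : Type u) (H : Type v) [Field K] [Ring H] [HopfAlgebra K H]

/-- The left adjoint coaction `h ↦ h₁ S(h₃) ⊗ h₂` of `H` on itself. -/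
def adCoaction : H →ₗ[K] H ⊗[K] H :=
  LinearMap.rTensor H (LinearMap.mul' K H ∘ₗ LinearMap.lTensor H (HopfAlgebra.antipode K)) ∘ₗ
    (TensorProduct.assoc K H H H).symm.toLinearMap ∘ₗ
    LinearMap.lTensor H ((TensorProduct.comm K H H).toLinearMap ∘ₗ Coalgebra.comul) ∘ₗ
    Coalgebra.comul

/-- `t` is an ad-coinvariant integral: `h t = ε(h) t` for all `h`, `t₁ S(t₃) ⊗ t₂ = 1 ⊗ t`
and `ε(t) = 1`. -/
structure IsAdCoinvariantIntegral (t : H) : Prop where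
  mul_left : ∀ h : H, h * t = Coalgebra.counit (R := K) h • t
  coinvariant : adCoaction K H t = 1 ⊗ₜ[K] t
  counit_eq_one : Coalgebra.counit (R := K) t = 1

variable (E : Type w) [AddCommGroup E] [Module K E]

/-- The diagonal operator of `h` on `E ⊗ E`, namely `x ⊗ y ↦ a(h₁) x ⊗ a(h₂) y`, for a family
`a` of operators on `E` indexed linearly by `H`. -/
def diagonal (a : H →ₗ[K] Module.End K E) : H →ₗ[K] Module.End K (E ⊗[K] E) :=
  TensorProduct.homTensorHomMap (RingHom.id K) E E E E ∘ₗ TensorProduct.map a a ∘ₗ Coalgebra.comul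

/-- The right action of `H` on a right `H`-module, `h ↦ (x ↦ x h)`. -/
def rightAct [Module Hᵐᵒᵖ E] [IsScalarTower K Hᵐᵒᵖ E] : H →ₗ[K] Module.End K E :=
  (Algebra.lsmul K K E : Hᵐᵒᵖ →ₐ[K] Module.End K E).toLinearMap ∘ₗ
    (MulOpposite.opLinearEquiv K).toLinearMap

/-- The left action of `H` on a left `H`-module, `h ↦ (x ↦ h x)`. -/
def leftAct [Module H E] [IsScalarTower K H E] : H →ₗ[K] Module.End K E :=
  (Algebra.lsmul K K E : H →ₐ[K] Module.End K E).toLinearMap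

/-- The coalgebra `E`, which is also a right `H`-module, is a coalgebra in the monoidal category
of right `H`-modules: `Δ : E → E ⊗ E` and `ε : E → K` are right `H`-linear, where `H` acts on
`E ⊗ E` diagonally and on `K` through the counit. -/
structure IsRightModuleCoalgebra [Coalgebra K E] [Module Hᵐᵒᵖ E] [IsScalarTower K Hᵐᵒᵖ E] :
    Prop where
  comul_act : ∀ (h : H) (x : E), Coalgebra.comul (R := K) (MulOpposite.op h • x)
    = diagonal K H E (rightAct K H E) h (Coalgebra.comul (R := K) x)
  counit_act : ∀ (h : H) (x : E), Coalgebra.counit (R := K) (MulOpposite.op h • x)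
    = Coalgebra.counit (R := K) x * Coalgebra.counit (R := K) h

/-- The coalgebra `E`, which is also a left `H`-module, is a coalgebra in the monoidal category
of left `H`-modules: `Δ : E → E ⊗ E` and `ε : E → K` are left `H`-linear. -/
structure IsLeftModuleCoalgebra [Coalgebra K E] [Module H E] [IsScalarTower K H E] :
    Prop where
  comul_act : ∀ (h : H) (x : E), Coalgebra.comul (R := K) (h • x)
    = diagonal K H E (leftAct K H E) h (Coalgebra.comul (R := K) x)
  counit_act : ∀ (h : H) (x : E), Coalgebra.counit (R := K) (h • x)
    = Coalgebra.counit (R := K) h * Coalgebra.counit (R := K) x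

/-- The coalgebra `E`, which is also an `H`-bimodule, is a coalgebra in the monoidal category of
`H`-bimodules: `Δ` and `ε` are left and right `H`-linear. -/
structure IsBimoduleCoalgebra [Coalgebra K E] [Module H E] [IsScalarTower K H E]
    [Module Hᵐᵒᵖ E] [IsScalarTower K Hᵐᵒᵖ E] [SMulCommClass H Hᵐᵒᵖ E] : Prop where
  left : IsLeftModuleCoalgebra K H E
  right : IsRightModuleCoalgebra K H E

end Hopf

end HopfSplitting

end

/-! Write f∗g for the map x ↦ f(x₁) ⊗ g(x₂). A counital linear retraction σ : E → H of the inclusion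
fails to be a coalgebra map only by its defect φ = Δσ − σ∗σ, which vanishes on H. The idea is to
improve σ by Newton's method while keeping every iterate H-linear.

Formal smoothness supplies the inverse derivative. The cobar differential embeds Coker Δ in C ⊗ C ⊗
C by a bicolinear map with a linear retraction, so relative injectivity gives a bicolinear
retraction. Composing it with the coderivation a ⊗ b ↦ a ε(b) − ε(a) b yields a coderivation η : C ⊗
C ⊗ C → C (`IsFormallySmooth.exists_isSmoothing`). Since φ satisfies a cocycle identity, replacing σ
by σ − η(φ∗σ) leaves a defect whose every term is quadratic in φ (`comulDefect_newton`).

If φ vanishes on a subcoalgebra D, a quadratic expression in φ vanishes on D ∧ D, while σ is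
unchanged on D. So n steps make σ comultiplicative on the n-th repeated wedge square of H. These
squares exhaust E because H contains the coradical (`exists_mem_wedgeSeq`). Dually, the ideal H^⊥ of
the convolution algebra is nilpotent modulo the annihilator of each finite-dimensional subcoalgebra;
otherwise a maximal ideal not containing H^⊥ would give a simple subcoalgebra outside H. The
iterates are therefore eventually constant at each point, and their limit is a coalgebra retraction.

Linearity comes from averaging f ↦ Σ τ(b) f ρ(a) over the separability element t₁ ⊗ S(t₂). Any
integral with ε(t) = 1 makes averages linear. Ad-coinvariance makes averaging compatible with f ↦ id
⊗ f, so an averaged η is still a coderivation (`IsSmoothing.sandwich`). Once η and the initial σ are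
linear, so are all Newton iterates and the limit. -/

noncomputable section

namespace HopfSplitting

open TensorProduct Coalgebra WithConv


/-! ### Convolution of linear maps into a tensor product -/

section Convolution

variable {K : Type u} [Field K] {E : Type*} [AddCommGroup E] [Module K E] [Coalgebra K E]
  {M N P M' N' : Type*} [AddCommGroup M] [Module K M] [AddCommGroup N] [Module K N]
  [AddCommGroup P] [Module K P] [AddCommGroup M'] [Module K M'] [AddCommGroup N'] [Module K N']

/-- The convolution `x ↦ f(x₁) ⊗ g(x₂)` of two linear maps out of a coalgebra. -/
def tconv (f : E →ₗ[K] M) (g : E →ₗ[K] N) : E →ₗ[K] M ⊗[K] N :=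
  map f g ∘ₗ comul

lemma map_comp_tconv (u : M →ₗ[K] M') (v : N →ₗ[K] N') (f : E →ₗ[K] M) (g : E →ₗ[K] N) :
    map u v ∘ₗ tconv f g = tconv (u ∘ₗ f) (v ∘ₗ g) := by
  rw [tconv, tconv, ← LinearMap.comp_assoc, ← map_comp]

/-- Coassociativity of E, in the form in which all later computations with iterated coproducts use
it. -/
lemma assoc_comp_tconv (f : E →ₗ[K] M) (g : E →ₗ[K] N) (h : E →ₗ[K] P) :
    (TensorProduct.assoc K M N P).toLinearMap ∘ₗ tconv (tconv f g) h = tconv f (tconv g h) := by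
  have h1 : tconv (tconv f g) h = map (map f g) h ∘ₗ LinearMap.rTensor E comul ∘ₗ comul := by
    rw [← LinearMap.comp_assoc, LinearMap.rTensor_def, ← map_comp, LinearMap.comp_id]; rfl
  have h2 : tconv f (tconv g h) = map f (map g h) ∘ₗ LinearMap.lTensor E comul ∘ₗ comul := by
    rw [← LinearMap.comp_assoc, LinearMap.lTensor_def, ← map_comp, LinearMap.comp_id]; rfl
  rw [h1, h2, ← Coalgebra.coassoc, ← LinearMap.comp_assoc, ← map_map_comp_assoc_eq]
  rfl

lemma tconv_add_left (f g : E →ₗ[K] M) (h : E →ₗ[K] N) :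
    tconv (f + g) h = tconv f h + tconv g h := by
  simp [tconv, map_add_left, LinearMap.add_comp]

lemma tconv_add_right (h : E →ₗ[K] M) (f g : E →ₗ[K] N) :
    tconv h (f + g) = tconv h f + tconv h g := by
  simp [tconv, map_add_right, LinearMap.add_comp]

lemma tconv_sub_left (f g : E →ₗ[K] M) (h : E →ₗ[K] N) :
    tconv (f - g) h = tconv f h - tconv g h := by
  rw [eq_sub_iff_add_eq, ← tconv_add_left, sub_add_cancel]

lemma tconv_sub_right (h : E →ₗ[K] M) (f g : E →ₗ[K] N) :
    tconv h (f - g) = tconv h f - tconv h g := by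
  rw [eq_sub_iff_add_eq, ← tconv_add_right, sub_add_cancel]

lemma rid_comp_tconv_counit (f : E →ₗ[K] M) :
    (TensorProduct.rid K M).toLinearMap ∘ₗ tconv f (counit : E →ₗ[K] K) = f := by
  have h : tconv f (counit : E →ₗ[K] K) = LinearMap.rTensor K f ∘ₗ LinearMap.lTensor E counit ∘ₗ
      comul := by
    rw [← LinearMap.comp_assoc, LinearMap.rTensor_comp_lTensor]; rfl
  rw [h, Coalgebra.lTensor_counit_comp_comul]
  ext x
  simp

end Convolution

/-! ### The Newton iteration and its quadratic error -/

section Newton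

variable {K : Type u} {C : Type v} [Field K] [AddCommGroup C] [Module K C] [Coalgebra K C]

variable (K C) in
/-- The left coaction `Δ ⊗ C ⊗ C` on `C ⊗ C ⊗ C`. -/
def cofreeCoactL : C ⊗[K] (C ⊗[K] C) →ₗ[K] C ⊗[K] (C ⊗[K] (C ⊗[K] C)) :=
  (TensorProduct.assoc K C C (C ⊗[K] C)).toLinearMap ∘ₗ map comul LinearMap.id

variable (K C) in
/-- The right coaction `C ⊗ C ⊗ Δ` on `C ⊗ C ⊗ C`. -/
def cofreeCoactR : C ⊗[K] (C ⊗[K] C) →ₗ[K] (C ⊗[K] (C ⊗[K] C)) ⊗[K] C :=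
  (TensorProduct.assoc K C (C ⊗[K] C) C).symm.toLinearMap ∘ₗ
    map LinearMap.id ((TensorProduct.assoc K C C C).symm.toLinearMap ∘ₗ map LinearMap.id comul)

/-- A coderivation `η : C ⊗ C ⊗ C → C` that restricts to the universal coderivation along the
embedding of `Coker Δ` in `C ⊗ C ⊗ C`. -/
structure IsSmoothing (η : C ⊗[K] (C ⊗[K] C) →ₗ[K] C) : Prop where
  coderivation : comul ∘ₗ η
    = map LinearMap.id η ∘ₗ cofreeCoactL K C + map η LinearMap.id ∘ₗ cofreeCoactR K C
  boundary : η ∘ₗ (TensorProduct.assoc K C C C).toLinearMap ∘ₗ map comul LinearMap.id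
      - η ∘ₗ map LinearMap.id comul
    = (TensorProduct.rid K C).toLinearMap ∘ₗ map LinearMap.id counit
      - (TensorProduct.lid K C).toLinearMap ∘ₗ map counit LinearMap.id

/-- Applying ε ⊗ ε to the coderivation identity gives εη = εη + εη, whence εη = 0 in every
characteristic. -/
lemma IsSmoothing.counit_comp {η : C ⊗[K] (C ⊗[K] C) →ₗ[K] C} (hη : IsSmoothing η) :
    counit ∘ₗ η = 0 := by
  have h := congrArg (fun f ↦ (TensorProduct.lid K K).toLinearMap ∘ₗ map counit counit ∘ₗ f)
    hη.coderivation
  simp only [LinearMap.comp_add] at h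
  have e1 : (TensorProduct.lid K K).toLinearMap ∘ₗ map counit counit ∘ₗ comul ∘ₗ η
      = counit ∘ₗ η := by
    ext x y z
    have := Coalgebra.rTensor_counit_comul (R := K) (η (x ⊗ₜ (y ⊗ₜ z)))
    have h2 := congrArg (LinearMap.lTensor K (counit (R := K) (A := C))) this
    rw [← LinearMap.comp_apply, LinearMap.lTensor_comp_rTensor] at h2
    simp [h2]
  have e2 : (TensorProduct.lid K K).toLinearMap ∘ₗ map counit counit ∘ₗ
      map LinearMap.id η ∘ₗ cofreeCoactL K C = counit ∘ₗ η := by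
    ext x y z
    have key : ∀ s : C ⊗[K] C, TensorProduct.lid K K (map counit counit
        (map LinearMap.id η (TensorProduct.assoc K C C (C ⊗[K] C) (s ⊗ₜ (y ⊗ₜ z)))))
        = counit (η (TensorProduct.lid K C (LinearMap.rTensor C counit s) ⊗ₜ (y ⊗ₜ z))) := by
      intro s
      induction s with
      | zero => simp
      | add a b ha hb => simp only [add_tmul, map_add, ha, hb]
      | tmul a b => simp [← TensorProduct.smul_tmul']
    simp [cofreeCoactL, key]
  have e3 : (TensorProduct.lid K K).toLinearMap ∘ₗ map counit counit ∘ₗ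
      map η LinearMap.id ∘ₗ cofreeCoactR K C = counit ∘ₗ η := by
    ext x y z
    have key : ∀ s : C ⊗[K] C, TensorProduct.lid K K (map counit counit
        (map η LinearMap.id ((TensorProduct.assoc K C (C ⊗[K] C) C).symm
          (x ⊗ₜ ((TensorProduct.assoc K C C C).symm (y ⊗ₜ s))))))
        = counit (η (x ⊗ₜ (y ⊗ₜ TensorProduct.rid K C (LinearMap.lTensor C counit s)))) := by
      intro s
      induction s with
      | zero => simp
      | add a b ha hb => simp only [tmul_add, map_add, ha, hb]
      | tmul a b => simp [mul_comm]
    simp [cofreeCoactR, key]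
  rw [e1, e2, e3] at h
  exact left_eq_add.mp h

variable {E : Type w} [AddCommGroup E] [Module K E] [Coalgebra K E]

/-- The failure `Δσ - (σ ⊗ σ)Δ` of a linear map to be comultiplicative. -/
def comulDefect (σ : E →ₗ[K] C) : E →ₗ[K] C ⊗[K] C := comul ∘ₗ σ - tconv σ σ

/-- The correction term of the Newton iteration. -/
def newtonCorrection (η : C ⊗[K] (C ⊗[K] C) →ₗ[K] C) (σ : E →ₗ[K] C) : E →ₗ[K] C :=
  η ∘ₗ (TensorProduct.assoc K C C C).toLinearMap ∘ₗ tconv (comulDefect σ) σ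

/-- One step of the Newton iteration towards a coalgebra homomorphism. -/
def newton (η : C ⊗[K] (C ⊗[K] C) →ₗ[K] C) (σ : E →ₗ[K] C) : E →ₗ[K] C :=
  σ - newtonCorrection η σ

lemma comul_comp_eq (σ : E →ₗ[K] C) : comul ∘ₗ σ = comulDefect σ + tconv σ σ := by
  simp [comulDefect]

/-- The correction takes values in ker ε, so the iteration stays among counital maps, as the error
estimate requires. -/
lemma counit_comp_newton {η : C ⊗[K] (C ⊗[K] C) →ₗ[K] C} (hη : IsSmoothing η)
    {σ : E →ₗ[K] C} (hσ : counit ∘ₗ σ = (counit : E →ₗ[K] K)) :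
    counit ∘ₗ newton η σ = (counit : E →ₗ[K] K) := by
  rw [newton, LinearMap.comp_sub, newtonCorrection, ← LinearMap.comp_assoc, hη.counit_comp,
    LinearMap.zero_comp, sub_zero, hσ]

/-- Coassociativity of C cancels the two terms in Δσ, and coassociativity of E cancels the two
copies of σ∗σ∗σ; the mixed terms in Δσ and σ assemble into σ∗φ − φ∗σ. This cocycle property is what
lets η solve for the correction. -/
lemma comulDefect_cocycle (σ : E →ₗ[K] C) :
    (TensorProduct.assoc K C C C).toLinearMap ∘ₗ map comul LinearMap.id ∘ₗ comulDefect σ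
      = map LinearMap.id comul ∘ₗ comulDefect σ + tconv σ (comulDefect σ)
        - (TensorProduct.assoc K C C C).toLinearMap ∘ₗ tconv (comulDefect σ) σ := by
  have h : (TensorProduct.assoc K C C C).toLinearMap ∘ₗ map comul LinearMap.id ∘ₗ comul ∘ₗ σ
      = map LinearMap.id comul ∘ₗ comul ∘ₗ σ := by
    have := congrArg (fun f ↦ f ∘ₗ σ) (Coalgebra.coassoc (R := K) (A := C))
    simpa only [LinearMap.comp_assoc, LinearMap.rTensor_def, LinearMap.lTensor_def] using this
  have e : comulDefect σ = comul ∘ₗ σ - tconv σ σ := rfl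
  rw [e]
  simp only [LinearMap.comp_sub, h, map_comp_tconv, LinearMap.id_comp, tconv_sub_left,
    tconv_sub_right, assoc_comp_tconv]
  abel

/-- The Newton iteration squares the comultiplicativity defect. -/
lemma comulDefect_newton {η : C ⊗[K] (C ⊗[K] C) →ₗ[K] C} (hη : IsSmoothing η)
    {σ : E →ₗ[K] C} (hσ : counit ∘ₗ σ = (counit : E →ₗ[K] K)) :
    comulDefect (newton η σ)
      = - map LinearMap.id η ∘ₗ (TensorProduct.assoc K C C (C ⊗[K] C)).toLinearMap ∘ₗ
          tconv (comulDefect σ) (comulDefect σ)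
        - map (η ∘ₗ (TensorProduct.assoc K C C C).toLinearMap) LinearMap.id ∘ₗ
          (TensorProduct.assoc K (C ⊗[K] C) C C).symm.toLinearMap ∘ₗ
          tconv (comulDefect σ) (comulDefect σ)
        - tconv (newtonCorrection η σ) (newtonCorrection η σ) := by
  set φ := comulDefect σ with hφ
  set κ := newtonCorrection η σ with hκ
  have hc : comul ∘ₗ σ = φ + tconv σ σ := comul_comp_eq σ
  let A := (TensorProduct.assoc K C C C).toLinearMap
  -- The right coaction only comultiplies the last leg, turning φ∗σ into φ∗Δσ = φ∗φ + φ∗(σ∗σ).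
  have hR : map η LinearMap.id ∘ₗ cofreeCoactR K C ∘ₗ A ∘ₗ tconv φ σ
      = map (η ∘ₗ A) LinearMap.id ∘ₗ (TensorProduct.assoc K (C ⊗[K] C) C C).symm.toLinearMap ∘ₗ
          tconv φ φ + tconv κ σ := by
    have h1 : cofreeCoactR K C ∘ₗ A = map A LinearMap.id ∘ₗ
        (TensorProduct.assoc K (C ⊗[K] C) C C).symm.toLinearMap ∘ₗ map LinearMap.id comul := by
      ext a b c
      simp only [A, cofreeCoactR, AlgebraTensorModule.curry_apply, curry_apply,
        LinearMap.coe_restrictScalars, LinearMap.coe_comp, Function.comp_apply,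
        LinearEquiv.coe_coe, assoc_tmul, map_tmul, LinearMap.id_coe, id_eq]
      generalize comul (R := K) c = s
      induction s with
      | zero => simp
      | add x y hx hy => simp only [tmul_add, map_add, hx, hy]
      | tmul x y => simp
    have h2 : (TensorProduct.assoc K (C ⊗[K] C) C C).symm.toLinearMap ∘ₗ tconv φ (tconv σ σ)
        = tconv (tconv φ σ) σ := by
      rw [← assoc_comp_tconv, ← LinearMap.comp_assoc]; simp
    have h3 := congrArg (fun f ↦ map η LinearMap.id ∘ₗ f ∘ₗ tconv φ σ) h1
    simp only [LinearMap.comp_assoc] at h3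
    rw [h3, map_comp_tconv, hc, LinearMap.id_comp, tconv_add_right,
      LinearMap.comp_add, LinearMap.comp_add, LinearMap.comp_add, h2, map_comp_tconv,
      map_comp_tconv, CoassocSimps.TensorProduct.map_comp_assoc]
    rfl
  -- The left coaction comultiplies the first leg of φ. The cocycle identity splits the result into
  -- three terms, and the boundary condition on η extracts from one of them the linear term φ that
  -- the Newton step must cancel.
  have hL : map LinearMap.id η ∘ₗ cofreeCoactL K C ∘ₗ A ∘ₗ tconv φ σ
      = φ + map LinearMap.id η ∘ₗ (TensorProduct.assoc K C C (C ⊗[K] C)).toLinearMap ∘ₗ tconv φ φ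
        + tconv σ κ := by
    let B := (TensorProduct.assoc K C (C ⊗[K] C) C).toLinearMap
    have h1 : cofreeCoactL K C ∘ₗ A ∘ₗ tconv φ σ
        = map LinearMap.id A ∘ₗ B ∘ₗ tconv (A ∘ₗ map comul LinearMap.id ∘ₗ φ) σ := by
      have : cofreeCoactL K C ∘ₗ A
          = map LinearMap.id A ∘ₗ B ∘ₗ map (A ∘ₗ map comul LinearMap.id) LinearMap.id := by
        ext a b c
        simp only [A, B, cofreeCoactL, AlgebraTensorModule.curry_apply, curry_apply,
          LinearMap.coe_restrictScalars, LinearMap.coe_comp, Function.comp_apply,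
          LinearEquiv.coe_coe, assoc_tmul, map_tmul, LinearMap.id_coe, id_eq]
        generalize comul (R := K) a = s
        induction s with
        | zero => simp
        | add x y hx hy => simp only [add_tmul, map_add, hx, hy]
        | tmul x y => simp
      have h := congrArg (fun f ↦ f ∘ₗ tconv φ σ) this
      simpa only [LinearMap.comp_assoc, map_comp_tconv, LinearMap.id_comp] using h
    have e1 : map LinearMap.id A ∘ₗ B ∘ₗ tconv (tconv σ φ) σ = tconv σ (A ∘ₗ tconv φ σ) := by
      rw [assoc_comp_tconv, map_comp_tconv, LinearMap.id_comp]
    have e2 : map LinearMap.id A ∘ₗ B ∘ₗ tconv (A ∘ₗ tconv φ σ) σ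
        = (TensorProduct.assoc K C C (C ⊗[K] C)).toLinearMap ∘ₗ tconv φ (tconv σ σ) := by
      have : map LinearMap.id A ∘ₗ B ∘ₗ map A LinearMap.id
          = (TensorProduct.assoc K C C (C ⊗[K] C)).toLinearMap ∘ₗ
            (TensorProduct.assoc K (C ⊗[K] C) C C).toLinearMap := by
        ext a b c d
        simp [A, B]
      have h := congrArg (fun f ↦ f ∘ₗ tconv (tconv φ σ) σ) this
      simpa only [LinearMap.comp_assoc, map_comp_tconv, LinearMap.id_comp, assoc_comp_tconv]
        using h
    -- Trading (1 ⊗ Δ)φ for Δσ through the boundary condition costs two counit terms: one equals φ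
    -- because εσ = ε, the other vanishes because (1 ⊗ ε)φ = 0.
    have e3 : map LinearMap.id η ∘ₗ map LinearMap.id A ∘ₗ B ∘ₗ
          tconv (map LinearMap.id comul ∘ₗ φ) σ
        = map LinearMap.id η ∘ₗ (TensorProduct.assoc K C C (C ⊗[K] C)).toLinearMap ∘ₗ
            tconv φ (comul ∘ₗ σ) + φ := by
      let D := (TensorProduct.assoc K C C C).toLinearMap
      have hb : η ∘ₗ A ∘ₗ map comul LinearMap.id = η ∘ₗ map LinearMap.id comul
          + ((TensorProduct.rid K C).toLinearMap ∘ₗ map LinearMap.id counit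
            - (TensorProduct.lid K C).toLinearMap ∘ₗ map counit LinearMap.id) :=
        sub_eq_iff_eq_add'.mp hη.boundary
      have i1 : B ∘ₗ map (map LinearMap.id comul) LinearMap.id
          = map LinearMap.id (map comul LinearMap.id) ∘ₗ D := by
        ext a b c; simp [B, D]
      have i2 : map LinearMap.id (map LinearMap.id comul) ∘ₗ D
          = (TensorProduct.assoc K C C (C ⊗[K] C)).toLinearMap ∘ₗ map LinearMap.id comul := by
        ext a b c; simp [D]
      have i3 : map LinearMap.id ((TensorProduct.rid K C).toLinearMap ∘ₗ
            map LinearMap.id counit) ∘ₗ D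
          = (TensorProduct.rid K (C ⊗[K] C)).toLinearMap ∘ₗ map LinearMap.id counit := by
        ext a b c; simp [D]
      have i4 : map LinearMap.id ((TensorProduct.lid K C).toLinearMap ∘ₗ
            map counit LinearMap.id) ∘ₗ D
          = map ((TensorProduct.rid K C).toLinearMap ∘ₗ map LinearMap.id counit)
            LinearMap.id := by
        ext a b c; simp [D, TensorProduct.smul_tmul]
      have i5 : (TensorProduct.rid K C).toLinearMap ∘ₗ map LinearMap.id counit ∘ₗ φ = 0 := by
        have : (TensorProduct.rid K C).toLinearMap ∘ₗ map LinearMap.id counit ∘ₗ comul ∘ₗ σ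
            = σ := by
          ext x
          have := Coalgebra.lTensor_counit_comul (R := K) (σ x)
          rw [LinearMap.lTensor_def] at this
          simp [this]
        rw [hφ, comulDefect, LinearMap.comp_sub, LinearMap.comp_sub, this, map_comp_tconv, hσ,
          LinearMap.id_comp, rid_comp_tconv_counit, sub_self]
      have hsub (f g : C ⊗[K] C →ₗ[K] C) :
          map (LinearMap.id : C →ₗ[K] C) (f - g) = map LinearMap.id f - map LinearMap.id g := by
        rw [eq_sub_iff_add_eq, ← map_add_right, sub_add_cancel]
      calc _ = map LinearMap.id (η ∘ₗ A) ∘ₗ (B ∘ₗ map (map LinearMap.id comul) LinearMap.id) ∘ₗ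
            tconv φ σ := by
              rw [LinearMap.comp_assoc, map_comp_tconv,
                CoassocSimps.TensorProduct.map_comp_assoc]
              rfl
        _ = (map LinearMap.id (η ∘ₗ A ∘ₗ map comul LinearMap.id) ∘ₗ D) ∘ₗ tconv φ σ := by
              rw [i1, ← LinearMap.comp_assoc, ← LinearMap.comp_assoc, ← map_comp]
              rfl
        _ = map LinearMap.id η ∘ₗ (map LinearMap.id (map LinearMap.id comul) ∘ₗ D) ∘ₗ tconv φ σ
            + (map LinearMap.id ((TensorProduct.rid K C).toLinearMap ∘ₗ
                map LinearMap.id counit) ∘ₗ D) ∘ₗ tconv φ σ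
            - (map LinearMap.id ((TensorProduct.lid K C).toLinearMap ∘ₗ
                map counit LinearMap.id) ∘ₗ D) ∘ₗ tconv φ σ := by
              rw [hb, map_add_right, hsub, LinearMap.add_comp, LinearMap.sub_comp,
                LinearMap.add_comp, LinearMap.sub_comp, add_sub_assoc]
              congr 1
              rw [← LinearMap.comp_assoc, ← LinearMap.comp_assoc, ← map_comp, LinearMap.id_comp]
        _ = _ := by
              rw [i2, i3, i4, map_comp_tconv]
              simp only [LinearMap.comp_assoc]
              rw [i5, map_comp_tconv, map_comp_tconv, hσ, LinearMap.id_comp,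
                rid_comp_tconv_counit]
              simp [tconv]
    rw [h1, comulDefect_cocycle, tconv_sub_left, tconv_add_left]
    simp only [LinearMap.comp_sub, LinearMap.comp_add]
    rw [e1, e3]
    have e2' := congrArg (fun f ↦ map LinearMap.id η ∘ₗ f) e2
    rw [e2', map_comp_tconv, hc, tconv_add_right]
    simp only [LinearMap.comp_add, LinearMap.id_comp]
    have : η ∘ₗ A ∘ₗ tconv φ σ = κ := rfl
    rw [this]
    abel
  -- Altogether Δκ = φ + σ∗κ + κ∗σ plus terms in φ∗φ. The new defect φ − Δκ + σ∗κ + κ∗σ − κ∗κ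
  -- therefore has no linear part in φ.
  have hΔκ : comul ∘ₗ κ = map LinearMap.id η ∘ₗ cofreeCoactL K C ∘ₗ A ∘ₗ tconv φ σ
      + map η LinearMap.id ∘ₗ cofreeCoactR K C ∘ₗ A ∘ₗ tconv φ σ := by
    have := congrArg (fun f ↦ f ∘ₗ A ∘ₗ tconv φ σ) hη.coderivation
    simpa only [LinearMap.add_comp, LinearMap.comp_assoc, hκ] using! this
  rw [comulDefect, newton, LinearMap.comp_sub, tconv_sub_left, tconv_sub_right, tconv_sub_right,
    hΔκ, hL, hR, hc]
  abel

end Newton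


/-! ### From formal smoothness to a smoothing coderivation -/

section FormallySmooth

variable (K : Type u) (C : Type v) [Field K] [AddCommGroup C] [Module K C] [Coalgebra K C]

/-- `C ⊗ C ⊗ C` is a bicomodule through `Δ ⊗ C ⊗ C` and `C ⊗ C ⊗ Δ`. -/
instance cofreeBicomodule : Bicomodule K C (C ⊗[K] (C ⊗[K] C)) where
  coactL := cofreeCoactL K C
  coactR := cofreeCoactR K C
  coassocL := by
    ext x y z
    have key : ∀ s : C ⊗[K] C,
        TensorProduct.assoc K C C (C ⊗[K] (C ⊗[K] C))
          (map comul LinearMap.id (TensorProduct.assoc K C C (C ⊗[K] C) (s ⊗ₜ[K] (y ⊗ₜ z))))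
        = map LinearMap.id (TensorProduct.assoc K C C (C ⊗[K] C)).toLinearMap
          (TensorProduct.assoc K C (C ⊗[K] C) (C ⊗[K] C)
            (TensorProduct.assoc K C C C (map comul LinearMap.id s) ⊗ₜ[K] (y ⊗ₜ z))) := by
      intro s
      induction s with
      | zero => simp
      | add a b ha hb => simp only [add_tmul, map_add, ha, hb]
      | tmul a b =>
        simp only [assoc_tmul, map_tmul, LinearMap.id_coe, id_eq]
        generalize (Coalgebra.comul (R := K) a) = w
        induction w with
        | zero => simp
        | add a b ha hb => simp only [add_tmul, map_add, ha, hb]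
        | tmul c d => simp
    have key2 : ∀ s : C ⊗[K] C,
        map LinearMap.id (cofreeCoactL K C) (TensorProduct.assoc K C C (C ⊗[K] C)
          (s ⊗ₜ[K] (y ⊗ₜ z)))
        = map LinearMap.id (TensorProduct.assoc K C C (C ⊗[K] C)).toLinearMap
          (TensorProduct.assoc K C (C ⊗[K] C) (C ⊗[K] C)
            ((map LinearMap.id comul s) ⊗ₜ[K] (y ⊗ₜ z))) := by
      intro s
      induction s with
      | zero => simp
      | add a b ha hb => simp only [add_tmul, map_add, ha, hb]
      | tmul a b => simp [cofreeCoactL]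
    have h := Coalgebra.coassoc_apply (R := K) x
    simp only [LinearMap.lTensor_def, LinearMap.rTensor_def] at h ⊢
    simp only [AlgebraTensorModule.curry_apply, curry_apply, LinearMap.coe_restrictScalars,
      LinearMap.coe_comp, Function.comp_apply, LinearEquiv.coe_coe]
    have e : cofreeCoactL K C (x ⊗ₜ (y ⊗ₜ z))
        = TensorProduct.assoc K C C (C ⊗[K] C) (comul x ⊗ₜ[K] (y ⊗ₜ z)) := by
      simp [cofreeCoactL]
    rw [e, key, key2, h]
  counitL := by
    ext x y z
    have key : ∀ s : C ⊗[K] C,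
        TensorProduct.lid K (C ⊗[K] (C ⊗[K] C)) (LinearMap.rTensor (C ⊗[K] (C ⊗[K] C)) counit
          (TensorProduct.assoc K C C (C ⊗[K] C) (s ⊗ₜ[K] (y ⊗ₜ z))))
        = (TensorProduct.lid K C (LinearMap.rTensor C counit s)) ⊗ₜ[K] (y ⊗ₜ z) := by
      intro s
      induction s with
      | zero => simp
      | add a b ha hb => simp only [add_tmul, map_add, ha, hb]
      | tmul a b => simp [TensorProduct.smul_tmul']
    simp [cofreeCoactL, key]
  coassocR := by
    ext x y z
    have e (s : C ⊗[K] C) : (TensorProduct.assoc K C (C ⊗[K] C) C).symm (x ⊗ₜ[K]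
          (TensorProduct.assoc K C C C).symm (y ⊗ₜ[K] s))
        = map (TensorProduct.mk K C (C ⊗[K] C) x ∘ₗ TensorProduct.mk K C C y) LinearMap.id s := by
      induction s with
      | zero => simp
      | add a b ha hb => simp only [tmul_add, map_add, ha, hb]
      | tmul a b => simp
    have e' (c : C) : cofreeCoactR K C (x ⊗ₜ (y ⊗ₜ c)) = map (TensorProduct.mk K C (C ⊗[K] C) x ∘ₗ
        TensorProduct.mk K C C y) LinearMap.id (comul c) := by
      simp only [cofreeCoactR, LinearMap.coe_comp, Function.comp_apply, map_tmul,
        LinearMap.id_coe, id_eq, LinearEquiv.coe_coe, e]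
    have key : ∀ s : C ⊗[K] C,
        TensorProduct.assoc K (C ⊗[K] (C ⊗[K] C)) C C (map (cofreeCoactR K C) LinearMap.id
          (map (TensorProduct.mk K C (C ⊗[K] C) x ∘ₗ TensorProduct.mk K C C y) LinearMap.id s))
        = map (TensorProduct.mk K C (C ⊗[K] C) x ∘ₗ TensorProduct.mk K C C y) LinearMap.id
            (TensorProduct.assoc K C C C (map comul LinearMap.id s)) := by
      intro s
      induction s with
      | zero => simp
      | add a b ha hb => simp only [map_add, ha, hb]
      | tmul a b =>
        simp only [map_tmul, LinearMap.coe_comp, Function.comp_apply, mk_apply,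
          LinearMap.id_coe, id_eq, e']
        generalize (Coalgebra.comul (R := K) a) = w
        induction w with
        | zero => simp
        | add a b ha hb => simp only [add_tmul, map_add, ha, hb]
        | tmul c d => simp
    have key2 : ∀ s : C ⊗[K] C,
        map LinearMap.id comul
          (map (TensorProduct.mk K C (C ⊗[K] C) x ∘ₗ TensorProduct.mk K C C y) LinearMap.id s)
        = map (TensorProduct.mk K C (C ⊗[K] C) x ∘ₗ TensorProduct.mk K C C y) LinearMap.id
            (map LinearMap.id comul s) := by
      intro s
      induction s with
      | zero => simp
      | add a b ha hb => simp only [map_add, ha, hb]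
      | tmul a b => simp
    have h := Coalgebra.coassoc_apply (R := K) z
    simp only [LinearMap.lTensor_def, LinearMap.rTensor_def] at h ⊢
    simp only [AlgebraTensorModule.curry_apply, curry_apply, LinearMap.coe_restrictScalars,
      LinearMap.coe_comp, Function.comp_apply, LinearEquiv.coe_coe]
    rw [e', key, key2, h]
  counitR := by
    ext x y z
    have key : ∀ s : C ⊗[K] C,
        TensorProduct.rid K (C ⊗[K] (C ⊗[K] C)) (LinearMap.lTensor (C ⊗[K] (C ⊗[K] C)) counit
          ((TensorProduct.assoc K C (C ⊗[K] C) C).symm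
            (x ⊗ₜ[K] (TensorProduct.assoc K C C C).symm (y ⊗ₜ[K] s))))
        = x ⊗ₜ[K] (y ⊗ₜ[K] TensorProduct.rid K C (LinearMap.lTensor C counit s)) := by
      intro s
      induction s with
      | zero => simp
      | add a b ha hb => simp only [tmul_add, map_add, ha, hb]
      | tmul a b => simp
    simp [cofreeCoactR, key]
  compat := by
    ext x y z
    have key : ∀ s t : C ⊗[K] C,
        TensorProduct.assoc K C (C ⊗[K] (C ⊗[K] C)) C
          (map (TensorProduct.assoc K C C (C ⊗[K] C)).toLinearMap LinearMap.id
            ((TensorProduct.assoc K (C ⊗[K] C) (C ⊗[K] C) C).symm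
              (s ⊗ₜ[K] (TensorProduct.assoc K C C C).symm (y ⊗ₜ[K] t))))
        = map LinearMap.id (TensorProduct.assoc K C (C ⊗[K] C) C).symm.toLinearMap
          (TensorProduct.assoc K C C ((C ⊗[K] C) ⊗[K] C)
            (s ⊗ₜ[K] (TensorProduct.assoc K C C C).symm (y ⊗ₜ[K] t))) := by
      intro s t
      induction s with
      | zero => simp
      | add a b ha hb => simp only [add_tmul, map_add, ha, hb]
      | tmul a b =>
        induction t with
        | zero => simp
        | add a b ha hb => simp only [tmul_add, map_add, ha, hb]
        | tmul c d => simp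
    have key2 : ∀ t : C ⊗[K] C,
        map (cofreeCoactL K C) LinearMap.id ((TensorProduct.assoc K C (C ⊗[K] C) C).symm
            (x ⊗ₜ[K] (TensorProduct.assoc K C C C).symm (y ⊗ₜ[K] t)))
        = map (TensorProduct.assoc K C C (C ⊗[K] C)).toLinearMap LinearMap.id
            ((TensorProduct.assoc K (C ⊗[K] C) (C ⊗[K] C) C).symm
              (comul x ⊗ₜ[K] (TensorProduct.assoc K C C C).symm (y ⊗ₜ[K] t))) := by
      intro t
      induction t with
      | zero => simp
      | add a b ha hb => simp only [tmul_add, map_add, ha, hb]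
      | tmul c d => simp [cofreeCoactL]
    have key3 : ∀ s : C ⊗[K] C,
        map LinearMap.id (cofreeCoactR K C) (TensorProduct.assoc K C C (C ⊗[K] C)
          (s ⊗ₜ[K] (y ⊗ₜ[K] z)))
        = map LinearMap.id (TensorProduct.assoc K C (C ⊗[K] C) C).symm.toLinearMap
          (TensorProduct.assoc K C C ((C ⊗[K] C) ⊗[K] C)
            (s ⊗ₜ[K] (TensorProduct.assoc K C C C).symm (y ⊗ₜ[K] comul z))) := by
      intro s
      induction s with
      | zero => simp
      | add a b ha hb => simp only [add_tmul, map_add, ha, hb]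
      | tmul c d => simp [cofreeCoactR]
    simp only [LinearMap.lTensor_def, LinearMap.rTensor_def]
    simp only [AlgebraTensorModule.curry_apply, curry_apply, LinearMap.coe_restrictScalars,
      LinearMap.coe_comp, Function.comp_apply, LinearEquiv.coe_coe]
    have e : cofreeCoactL K C (x ⊗ₜ (y ⊗ₜ z))
        = TensorProduct.assoc K C C (C ⊗[K] C) (comul x ⊗ₜ[K] (y ⊗ₜ z)) := by
      simp [cofreeCoactL]
    have e' : cofreeCoactR K C (x ⊗ₜ (y ⊗ₜ z)) = (TensorProduct.assoc K C (C ⊗[K] C) C).symm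
            (x ⊗ₜ[K] (TensorProduct.assoc K C C C).symm (y ⊗ₜ[K] comul z)) := by
      simp [cofreeCoactR]
    rw [e, e', key3, key2, key]

/-- The differential `a ⊗ b ↦ Δ(a) ⊗ b - a ⊗ Δ(b)` of the cobar resolution. -/
def cobarDiff : C ⊗[K] C →ₗ[K] C ⊗[K] (C ⊗[K] C) :=
  (TensorProduct.assoc K C C C).toLinearMap ∘ₗ LinearMap.rTensor C comul -
    LinearMap.lTensor C comul

/-- The map `a ⊗ b ↦ a ε(b) - ε(a) b`, the universal coderivation modulo `Δ`. -/
def counitDiff : C ⊗[K] C →ₗ[K] C :=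
  (TensorProduct.rid K C).toLinearMap ∘ₗ LinearMap.lTensor C counit
    - (TensorProduct.lid K C).toLinearMap ∘ₗ LinearMap.rTensor C counit

lemma cobarDiff_comp_comul : cobarDiff K C ∘ₗ comul = 0 := by
  rw [cobarDiff, LinearMap.sub_comp, LinearMap.comp_assoc, Coalgebra.coassoc, sub_self]

lemma counitDiff_comp_comul : counitDiff K C ∘ₗ comul = 0 := by
  ext x
  simp [counitDiff]

/-- Each coaction is formally compatible with one of the two summands; for the other summand the
claim is coassociativity. -/
lemma cobarDiff_isBicolinear : IsBicolinear K C (cobarDiff K C) := by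
  constructor
  · ext x y
    have h1 : ∀ s : C ⊗[K] C, cofreeCoactL K C (TensorProduct.assoc K C C C (s ⊗ₜ y))
        = LinearMap.lTensor C (TensorProduct.assoc K C C C).toLinearMap
          (TensorProduct.assoc K C (C ⊗[K] C) C
            (TensorProduct.assoc K C C C (LinearMap.rTensor C comul s) ⊗ₜ y)) := by
      intro s
      induction s with
      | zero => simp
      | add a b ha hb => simp only [add_tmul, map_add, ha, hb]
      | tmul a b =>
        simp only [cofreeCoactL, LinearMap.coe_comp, Function.comp_apply, LinearEquiv.coe_coe,
          assoc_tmul, map_tmul, LinearMap.id_coe, id_eq, LinearMap.rTensor_tmul]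
        generalize comul (R := K) a = t
        induction t with
        | zero => simp
        | add a b ha hb => simp only [add_tmul, map_add, ha, hb]
        | tmul c d => simp
    have h2 : ∀ s : C ⊗[K] C, LinearMap.lTensor C (cobarDiff K C)
          (TensorProduct.assoc K C C C (s ⊗ₜ y))
        = LinearMap.lTensor C (TensorProduct.assoc K C C C).toLinearMap
          (TensorProduct.assoc K C (C ⊗[K] C) C (LinearMap.lTensor C comul s ⊗ₜ y))
          - TensorProduct.assoc K C C (C ⊗[K] C) (s ⊗ₜ comul y) := by
      intro s
      induction s with
      | zero => simp
      | add a b ha hb => simp only [add_tmul, map_add, ha, hb]; abel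
      | tmul a b => simp [cobarDiff]
    have e1 : coactL K C (C ⊗[K] C) (x ⊗ₜ y)
        = TensorProduct.assoc K C C C (comul x ⊗ₜ[K] y) := rfl
    have e2 : cofreeCoactL K C (x ⊗ₜ comul y)
        = TensorProduct.assoc K C C (C ⊗[K] C) (comul x ⊗ₜ[K] comul y) := rfl
    have e3 : cobarDiff K C (x ⊗ₜ y)
        = TensorProduct.assoc K C C C (comul x ⊗ₜ[K] y) - x ⊗ₜ[K] comul y := rfl
    have e4 : coactL K C (C ⊗[K] (C ⊗[K] C)) = cofreeCoactL K C := rfl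
    simp only [AlgebraTensorModule.curry_apply, curry_apply, LinearMap.coe_restrictScalars,
      LinearMap.coe_comp, Function.comp_apply]
    rw [e1, h2, e4, e3, map_sub, h1, e2, Coalgebra.coassoc_apply]
  · ext x y
    have h1 : ∀ s : C ⊗[K] C, cofreeCoactR K C (TensorProduct.assoc K C C C (s ⊗ₜ y))
        = LinearMap.rTensor C (TensorProduct.assoc K C C C).toLinearMap
          ((TensorProduct.assoc K (C ⊗[K] C) C C).symm (s ⊗ₜ comul y)) := by
      intro s
      induction s with
      | zero => simp
      | add a b ha hb => simp only [add_tmul, map_add, ha, hb]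
      | tmul a b =>
        simp only [cofreeCoactR, LinearMap.coe_comp, Function.comp_apply, LinearEquiv.coe_coe,
          assoc_tmul, map_tmul, LinearMap.id_coe, id_eq]
        generalize comul (R := K) y = t
        induction t with
        | zero => simp
        | add a b ha hb => simp only [tmul_add, map_add, ha, hb]
        | tmul c d => simp
    have h2 : ∀ t : C ⊗[K] C, LinearMap.rTensor C (cobarDiff K C)
          ((TensorProduct.assoc K C C C).symm (x ⊗ₜ t))
        = LinearMap.rTensor C (TensorProduct.assoc K C C C).toLinearMap
          ((TensorProduct.assoc K (C ⊗[K] C) C C).symm (comul x ⊗ₜ t))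
          - (TensorProduct.assoc K C (C ⊗[K] C) C).symm
            (x ⊗ₜ LinearMap.rTensor C comul t) := by
      intro s
      induction s with
      | zero => simp
      | add a b ha hb => simp only [tmul_add, map_add, ha, hb]; abel
      | tmul a b => simp [cobarDiff]
    have e1 : coactR K C (C ⊗[K] C) (x ⊗ₜ y)
        = (TensorProduct.assoc K C C C).symm (x ⊗ₜ[K] comul y) := rfl
    have e2 : cofreeCoactR K C (x ⊗ₜ comul y)
        = (TensorProduct.assoc K C (C ⊗[K] C) C).symm
          (x ⊗ₜ[K] (TensorProduct.assoc K C C C).symm (LinearMap.lTensor C comul (comul y))) :=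
      rfl
    have e3 : cobarDiff K C (x ⊗ₜ y)
        = TensorProduct.assoc K C C C (comul x ⊗ₜ[K] y) - x ⊗ₜ[K] comul y := rfl
    have e4 : coactR K C (C ⊗[K] (C ⊗[K] C)) = cofreeCoactR K C := rfl
    simp only [AlgebraTensorModule.curry_apply, curry_apply, LinearMap.coe_restrictScalars,
      LinearMap.coe_comp, Function.comp_apply]
    rw [e1, h2, e4, e3, map_sub, h1, e2, Coalgebra.coassoc_symm_apply]

/-- On a ⊗ b the left term is ε(b)Δ(a) − a ⊗ b and the right term is a ⊗ b − ε(a)Δ(b); the copies of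
a ⊗ b cancel. -/
lemma counitDiff_coderivation :
    comul ∘ₗ counitDiff K C = LinearMap.lTensor C (counitDiff K C) ∘ₗ coactL K C (C ⊗[K] C)
      + LinearMap.rTensor C (counitDiff K C) ∘ₗ coactR K C (C ⊗[K] C) := by
  ext x y
  have hx : ∀ s : C ⊗[K] C, LinearMap.lTensor C (counitDiff K C)
      (TensorProduct.assoc K C C C (s ⊗ₜ[K] y))
      = counit (R := K) y • s - TensorProduct.rid K C (LinearMap.lTensor C counit s) ⊗ₜ[K] y := by
    intro s
    induction s with
    | zero => simp
    | add a b ha hb => simp only [add_tmul, map_add, ha, hb, smul_add]; abel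
    | tmul a b => simp [counitDiff, TensorProduct.smul_tmul]
  have hy : ∀ s : C ⊗[K] C, LinearMap.rTensor C (counitDiff K C)
      ((TensorProduct.assoc K C C C).symm (x ⊗ₜ[K] s))
      = x ⊗ₜ[K] TensorProduct.lid K C (LinearMap.rTensor C counit s) - counit (R := K) x • s := by
    intro s
    induction s with
    | zero => simp
    | add a b ha hb => simp only [tmul_add, map_add, ha, hb, smul_add]; abel
    | tmul a b => simp [counitDiff, TensorProduct.smul_tmul']
  have e1 : coactL K C (C ⊗[K] C) (x ⊗ₜ y) = TensorProduct.assoc K C C C (comul x ⊗ₜ[K] y) := rfl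
  have e2 : coactR K C (C ⊗[K] C) (x ⊗ₜ y)
      = (TensorProduct.assoc K C C C).symm (x ⊗ₜ[K] comul y) := rfl
  simp only [AlgebraTensorModule.curry_apply, curry_apply, LinearMap.coe_restrictScalars,
      LinearMap.coe_comp, Function.comp_apply, LinearMap.add_apply, e1, e2, hx, hy]
  simp [counitDiff]

variable {K C}

/-- A formally smooth coalgebra admits a smoothing coderivation. -/
theorem IsFormallySmooth.exists_isSmoothing (h : IsFormallySmooth K C) :
    ∃ η : C ⊗[K] (C ⊗[K] C) →ₗ[K] C, IsSmoothing η := by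
  let R := LinearMap.range (comul (R := K) (A := C))
  let j : CokerComul K C →ₗ[K] C ⊗[K] (C ⊗[K] C) := R.liftQ (cobarDiff K C) <| by
    rintro _ ⟨c, rfl⟩
    exact LinearMap.congr_fun (cobarDiff_comp_comul K C) c
  let θ : CokerComul K C →ₗ[K] C := R.liftQ (counitDiff K C) <| by
    rintro _ ⟨c, rfl⟩
    exact LinearMap.congr_fun (counitDiff_comp_comul K C) c
  have hj : j ∘ₗ R.mkQ = cobarDiff K C := R.liftQ_mkQ _ _
  have hθ : θ ∘ₗ R.mkQ = counitDiff K C := R.liftQ_mkQ _ _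
  have hL : coactL K C (CokerComul K C) ∘ₗ R.mkQ
      = LinearMap.lTensor C R.mkQ ∘ₗ coactL K C (C ⊗[K] C) := R.liftQ_mkQ _ _
  have hR : coactR K C (CokerComul K C) ∘ₗ R.mkQ
      = LinearMap.rTensor C R.mkQ ∘ₗ coactR K C (C ⊗[K] C) := R.liftQ_mkQ _ _
  have hjb : IsBicolinear K C j := by
    constructor
    · apply Submodule.linearMap_qext
      rw [LinearMap.comp_assoc, LinearMap.comp_assoc, hL,
        ← LinearMap.comp_assoc _ _ (LinearMap.lTensor C j),
        ← LinearMap.lTensor_comp, hj]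
      exact (cobarDiff_isBicolinear K C).1
    · apply Submodule.linearMap_qext
      rw [LinearMap.comp_assoc, LinearMap.comp_assoc, hR,
        ← LinearMap.comp_assoc _ _ (LinearMap.rTensor C j),
        ← LinearMap.rTensor_comp, hj]
      exact (cobarDiff_isBicolinear K C).2
  have hid : IsBicolinear K C (LinearMap.id : CokerComul K C →ₗ[K] CokerComul K C) := by
    constructor <;> simp
  -- The linear retraction of j is induced by ε ⊗ 1 ⊗ 1, a contracting homotopy of the cobar
  -- complex: composed with the differential it gives the identity minus a map with values in the
  -- image of Δ. Relative injectivity, applied to the identity of Coker Δ, upgrades it to a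
  -- bicolinear retraction p.
  obtain ⟨p, hp, hpj⟩ := h (CokerComul K C) (C ⊗[K] (C ⊗[K] C)) j LinearMap.id hjb hid
    ⟨R.mkQ ∘ₗ (TensorProduct.lid K (C ⊗[K] C)).toLinearMap ∘ₗ LinearMap.rTensor _ counit, by
      apply Submodule.linearMap_qext
      rw [LinearMap.comp_assoc, LinearMap.comp_assoc, LinearMap.comp_assoc, hj]
      have : (TensorProduct.lid K (C ⊗[K] C)).toLinearMap ∘ₗ LinearMap.rTensor _ counit ∘ₗ
          cobarDiff K C = LinearMap.id - comul ∘ₗ (TensorProduct.lid K C).toLinearMap ∘ₗ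
            LinearMap.rTensor C counit := by
        ext x y
        have key : ∀ s : C ⊗[K] C,
            TensorProduct.lid K (C ⊗[K] C) (LinearMap.rTensor (C ⊗[K] C) Coalgebra.counit
              (TensorProduct.assoc K C C C (s ⊗ₜ[K] y)))
            = (TensorProduct.lid K C (LinearMap.rTensor C Coalgebra.counit s)) ⊗ₜ[K] y := by
          intro s
          induction s with
          | zero => simp
          | add a b ha hb => simp only [TensorProduct.add_tmul, map_add, ha, hb]
          | tmul a b => simp [TensorProduct.smul_tmul']
        simp [cobarDiff, key]
      rw [this, LinearMap.comp_sub, ← LinearMap.comp_assoc, LinearMap.range_mkQ_comp]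
      simp [R]⟩
  have hθc : comul ∘ₗ θ = LinearMap.lTensor C θ ∘ₗ coactL K C (CokerComul K C)
      + LinearMap.rTensor C θ ∘ₗ coactR K C (CokerComul K C) := by
    apply Submodule.linearMap_qext
    rw [LinearMap.add_comp, LinearMap.comp_assoc, LinearMap.comp_assoc, LinearMap.comp_assoc,
      hL, hR, ← LinearMap.comp_assoc _ _ (LinearMap.lTensor C θ), ← LinearMap.lTensor_comp,
      ← LinearMap.comp_assoc _ _ (LinearMap.rTensor C θ), ← LinearMap.rTensor_comp, hθ]
    exact counitDiff_coderivation K C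
  -- A coderivation precomposed with a bicolinear map is a coderivation; the boundary condition is p
  -- ∘ j = id followed by θ.
  refine ⟨θ ∘ₗ p, ?_, ?_⟩
  · rw [← LinearMap.comp_assoc, hθc, LinearMap.add_comp, LinearMap.comp_assoc,
      LinearMap.comp_assoc, hp.1, hp.2, ← LinearMap.comp_assoc, ← LinearMap.lTensor_comp,
      ← LinearMap.comp_assoc, ← LinearMap.rTensor_comp]
    rfl
  · have := congrArg (fun f ↦ θ ∘ₗ f ∘ₗ R.mkQ) hpj
    simp only [LinearMap.comp_assoc, hj, LinearMap.id_comp, hθ] at this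
    rw [cobarDiff, LinearMap.comp_sub, LinearMap.comp_sub] at this
    exact this

end FormallySmooth

/-! ### Maximal two-sided ideals avoiding a non-nilpotent ideal -/

section Rings

/-- A nonzero two-sided ideal of a semisimple ring avoids some maximal two-sided ideal. -/
lemma exists_maximal_twoSided_of_semisimple {S : Type*} [Ring S] [IsSemisimpleRing S]
    (I : Ideal S) [I.IsTwoSided] (hI : I ≠ ⊥) :
    ∃ N : Ideal S, N.IsTwoSided ∧ N ≠ ⊤ ∧ ¬ I ≤ N ∧
      ∀ N' : Ideal S, N'.IsTwoSided → N ≤ N' → N' = N ∨ N' = ⊤ := by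
  obtain ⟨L, hL⟩ := exists_isCompl I
  -- The right annihilator of I. It serves as a two-sided complement: a proper ideal containing R
  -- cannot also contain I, once I + R is the whole ring.
  let R : Ideal S :=
    { carrier := {b | ∀ x ∈ I, x * b = 0}
      add_mem' := fun ha hb x hx ↦ by rw [mul_add, ha x hx, hb x hx, add_zero]
      zero_mem' := fun x _ ↦ mul_zero x
      smul_mem' := fun c b hb x hx ↦ by
        rw [smul_eq_mul, ← mul_assoc]; exact hb _ (I.mul_mem_right c hx) }
  have hR2 : R.IsTwoSided := ⟨fun {a} b ha x hx ↦ by rw [← mul_assoc, ha x hx, zero_mul]⟩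
  have hRtop : R ≠ ⊤ := fun h ↦ hI <| (Submodule.eq_bot_iff _).mpr fun x hx ↦ by
    have h1 : (1 : S) ∈ R := h ▸ Submodule.mem_top
    simpa using h1 x hx
  -- Split 1 = e + f along the left-ideal decomposition. For x in I, the element xf = x − xe lies in
  -- I ∩ L = 0, so f annihilates I.
  have hsup : I ⊔ R = ⊤ := by
    have h1 : (1 : S) ∈ I ⊔ L := hL.sup_eq_top ▸ Submodule.mem_top
    obtain ⟨e, he, f, hf, hef⟩ := Submodule.mem_sup.mp h1
    rw [Ideal.eq_top_iff_one, ← hef]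
    refine add_mem (Submodule.mem_sup_left he) (Submodule.mem_sup_right fun x hx ↦ ?_)
    have h2 : x * f = x - x * e := by rw [eq_sub_iff_add_eq, ← mul_add, add_comm f, hef, mul_one]
    have h3 : x * f ∈ I ⊓ L :=
      ⟨h2 ▸ sub_mem hx (I.mul_mem_right e hx), L.mul_mem_left x hf⟩
    rwa [hL.inf_eq_bot] at h3
  obtain ⟨N, ⟨hN, hRN, hNtop⟩, hmax⟩ := set_has_maximal_iff_noetherian.mpr
    (inferInstance : IsNoetherian S S) {N : Ideal S | N.IsTwoSided ∧ R ≤ N ∧ N ≠ ⊤}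
    ⟨R, hR2, le_rfl, hRtop⟩
  refine ⟨N, hN, hNtop, fun h ↦ hNtop (top_le_iff.mp (hsup ▸ sup_le h hRN)), fun N' h2 hle ↦ ?_⟩
  by_contra! hne
  exact hmax N' ⟨h2, hRN.trans hle, hne.2⟩ (lt_of_le_of_ne hle (Ne.symm hne.1))

/-- If a two-sided ideal of a ring is not nilpotent modulo a two-sided ideal with Artinian
quotient, it avoids some maximal two-sided ideal above the latter. -/
lemma exists_maximal_twoSided {A : Type*} [Ring A] (N₀ P : Ideal A) [N₀.IsTwoSided]
    [P.IsTwoSided] [IsArtinianRing (A ⧸ N₀)] (hP : ∀ m : ℕ, ¬ P ^ m ≤ N₀) :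
    ∃ N : Ideal A, N.IsTwoSided ∧ N₀ ≤ N ∧ N ≠ ⊤ ∧ ¬ P ≤ N ∧
      ∀ N' : Ideal A, N'.IsTwoSided → N ≤ N' → N' = N ∨ N' = ⊤ := by
  let J := Ring.jacobson (A ⧸ N₀)
  have : IsSemisimpleRing ((A ⧸ N₀) ⧸ J) := IsSemiprimaryRing.isSemisimpleRing
  obtain ⟨n, hn⟩ := IsSemiprimaryRing.isNilpotent (R := A ⧸ N₀)
  let ψ : A →+* (A ⧸ N₀) ⧸ J := (Ideal.Quotient.mk J).comp (Ideal.Quotient.mk N₀)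
  have hψ : Function.Surjective ψ :=
    Ideal.Quotient.mk_surjective.comp Ideal.Quotient.mk_surjective
  have : RingHomSurjective ψ := ⟨hψ⟩
  -- If P died in the semisimple quotient, it would map into the Jacobson radical of A/N₀, which is
  -- nilpotent, and a power of P would lie in N₀.
  have hbot : P.map ψ ≠ ⊥ := by
    intro h
    have hPJ : ∀ x ∈ P, Ideal.Quotient.mk N₀ x ∈ J := fun x hx ↦ by
      have : ψ x ∈ P.map ψ := Ideal.mem_map_of_mem ψ hx
      rw [h, Submodule.mem_bot] at this
      exact Ideal.Quotient.eq_zero_iff_mem.mp this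
    have hpow : ∀ m : ℕ, P ^ m ≤ (J ^ m).comap (Ideal.Quotient.mk N₀) := by
      intro m
      induction m with
      | zero =>
        rw [Submodule.pow_zero, Submodule.pow_zero, Ideal.one_eq_top, Ideal.one_eq_top]
        simp
      | succ m ih =>
        rw [Ideal.IsTwoSided.pow_succ, Ideal.IsTwoSided.pow_succ, Ideal.mul_le]
        intro a ha b hb
        rw [Ideal.mem_comap, map_mul]
        exact Ideal.mul_mem_mul (hPJ a ha) (ih hb)
    refine hP n fun x hx ↦ ?_
    have := hpow n hx
    rw [show J ^ n = ⊥ from hn] at this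
    exact Ideal.Quotient.eq_zero_iff_mem.mp this
  obtain ⟨N, hN, hNtop, hPN, hmax⟩ := exists_maximal_twoSided_of_semisimple (P.map ψ) hbot
  refine ⟨N.comap ψ, inferInstance, fun x hx ↦ ?_, fun h ↦ hNtop ?_, fun h ↦ hPN ?_,
    fun N' hN' hle ↦ ?_⟩
  · have : ψ x = 0 := by
      change Ideal.Quotient.mk J (Ideal.Quotient.mk N₀ x) = 0
      rw [Ideal.Quotient.eq_zero_iff_mem.mpr hx, map_zero]
    rw [Ideal.mem_comap, this]
    exact N.zero_mem
  · exact Ideal.comap_eq_top_iff.mp h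
  · exact Ideal.map_le_iff_le_comap.mpr h
  · have hker : RingHom.ker ψ ≤ N' := le_trans (fun x hx ↦ by
      rw [Ideal.mem_comap, (RingHom.mem_ker).mp hx]; exact N.zero_mem) hle
    have hcm : (N'.map ψ).comap ψ = N' := by
      rw [Ideal.comap_map_of_surjective ψ hψ]
      exact sup_eq_left.mpr hker
    have h1 : N ≤ N'.map ψ := by
      rw [← Ideal.map_comap_of_surjective ψ hψ N]
      exact Ideal.map_mono hle
    rcases hmax (N'.map ψ) inferInstance h1 with h | h
    · left; rw [← hcm, h]
    · right; rw [← hcm, h, Ideal.comap_top]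

end Rings


/-! ### Detecting tensors by their slices -/

section Separation

variable {K : Type u} [Field K] {M N : Type*} [AddCommGroup M] [Module K M]
  [AddCommGroup N] [Module K N]

lemma eq_of_forall_dual {x y : M} (h : ∀ f : WithConv (M →ₗ[K] K), f.ofConv x = f.ofConv y) :
    x = y := by
  rw [← sub_eq_zero, ← Module.forall_dual_apply_eq_zero_iff K]
  intro f
  rw [map_sub, sub_eq_zero]
  exact h (toConv f)

/-- The slices along the coordinate functionals of a basis of M are the coefficients of z. -/
lemma eq_zero_of_forall_rTensor {z : M ⊗[K] N}
    (h : ∀ f : M →ₗ[K] K, TensorProduct.lid K N (LinearMap.rTensor N f z) = 0) : z = 0 := by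
  classical
  let b := Module.Basis.ofVectorSpace K M
  apply (TensorProduct.equivFinsuppOfBasisLeft b).injective
  ext i
  rw [TensorProduct.equivFinsuppOfBasisLeft_apply, h]
  simp

lemma eq_zero_of_forall_lTensor {z : M ⊗[K] N}
    (h : ∀ f : N →ₗ[K] K, TensorProduct.rid K M (LinearMap.lTensor M f z) = 0) : z = 0 := by
  classical
  let b := Module.Basis.ofVectorSpace K N
  apply (TensorProduct.equivFinsuppOfBasisRight b).injective
  ext i
  rw [TensorProduct.equivFinsuppOfBasisRight_apply, h]
  simp

lemma eq_zero_of_forall_map {z : M ⊗[K] N}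
    (h : ∀ (f : M →ₗ[K] K) (g : N →ₗ[K] K), TensorProduct.lid K K (map f g z) = 0) : z = 0 := by
  refine eq_zero_of_forall_rTensor fun f ↦ ?_
  rw [← Module.forall_dual_apply_eq_zero_iff K]
  intro g
  rw [← h f g]
  clear h
  induction z with
  | zero => simp
  | add a b ha hb => simp_all
  | tmul a b => simp

/-- A linear projection onto G, applied in either tensor factor, fixes z because it fixes all slices
of z in that factor. Applying it in both factors exhibits z in G ⊗ G. -/
lemma mem_range_map_subtype {G : Submodule K M} {z : M ⊗[K] M}
    (hl : ∀ f : M →ₗ[K] K, TensorProduct.lid K M (LinearMap.rTensor M f z) ∈ G)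
    (hr : ∀ f : M →ₗ[K] K, TensorProduct.rid K M (LinearMap.lTensor M f z) ∈ G) :
    z ∈ LinearMap.range (map G.subtype G.subtype) := by
  obtain ⟨p, hp⟩ := G.subtype.exists_leftInverse_of_injective G.ker_subtype
  have hpG : ∀ x ∈ G, G.subtype (p x) = x := fun x hx ↦
    congrArg G.subtype (LinearMap.congr_fun hp ⟨x, hx⟩)
  have h1 : LinearMap.lTensor M (G.subtype ∘ₗ p) z = z := by
    rw [← sub_eq_zero]
    refine eq_zero_of_forall_rTensor fun f ↦ ?_
    have : TensorProduct.lid K M (LinearMap.rTensor M f (LinearMap.lTensor M (G.subtype ∘ₗ p) z))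
        = G.subtype (p (TensorProduct.lid K M (LinearMap.rTensor M f z))) := by
      clear hl hr
      induction z with
      | zero => simp
      | add a b ha hb => simp_all
      | tmul a b => simp
    rw [map_sub, map_sub, this, hpG _ (hl f), sub_self]
  have h2 : LinearMap.rTensor M (G.subtype ∘ₗ p) z = z := by
    rw [← sub_eq_zero]
    refine eq_zero_of_forall_lTensor fun f ↦ ?_
    have : TensorProduct.rid K M (LinearMap.lTensor M f (LinearMap.rTensor M (G.subtype ∘ₗ p) z))
        = G.subtype (p (TensorProduct.rid K M (LinearMap.lTensor M f z))) := by
      clear hl hr h1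
      induction z with
      | zero => simp
      | add a b ha hb => simp_all
      | tmul a b => simp
    rw [map_sub, map_sub, this, hpG _ (hr f), sub_self]
  refine ⟨map p p z, ?_⟩
  rw [← LinearMap.comp_apply, ← map_comp]
  conv_rhs => rw [← h1, ← h2]
  rw [← LinearMap.comp_apply, LinearMap.lTensor_comp_rTensor]

end Separation

/-! ### Subcoalgebras, ideals of the dual algebra, and wedge powers -/

section DualAlgebra

variable (K : Type u) [Field K] (E : Type w) [AddCommGroup E] [Module K E] [Coalgebra K E]

/-- The convolution algebra dual to a coalgebra. -/
abbrev DualAlgebra := WithConv (E →ₗ[K] K)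

variable {K E}

/-- The operator `x ↦ f(x₁) x₂`. -/
def hitL (f : E →ₗ[K] K) : E →ₗ[K] E :=
  (TensorProduct.lid K E).toLinearMap ∘ₗ LinearMap.rTensor E f ∘ₗ comul

/-- The operator `x ↦ x₁ f(x₂)`. -/
def hitR (f : E →ₗ[K] K) : E →ₗ[K] E :=
  (TensorProduct.rid K E).toLinearMap ∘ₗ LinearMap.lTensor E f ∘ₗ comul

/-- The operators are transposes of multiplications in the dual algebra, so identities between them
reduce to associativity of convolution. -/
lemma apply_hitL (f g : DualAlgebra K E) (x : E) :
    g.ofConv (hitL f.ofConv x) = (f * g).ofConv x := by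
  change g.ofConv _ = LinearMap.mul' K K (map f.ofConv g.ofConv (comul x))
  simp only [hitL, LinearMap.coe_comp, Function.comp_apply, LinearEquiv.coe_coe]
  generalize comul (R := K) x = z
  induction z with
  | zero => simp
  | add a b ha hb => simp_all
  | tmul a b => simp

lemma apply_hitR (f g : DualAlgebra K E) (x : E) :
    f.ofConv (hitR g.ofConv x) = (f * g).ofConv x := by
  change f.ofConv _ = LinearMap.mul' K K (map f.ofConv g.ofConv (comul x))
  simp only [hitR, LinearMap.coe_comp, Function.comp_apply, LinearEquiv.coe_coe]
  generalize comul (R := K) x = z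
  induction z with
  | zero => simp
  | add a b ha hb => simp_all
  | tmul a b => simp [mul_comm]

lemma hitL_hitL (f g : DualAlgebra K E) (x : E) :
    hitL f.ofConv (hitL g.ofConv x) = hitL (g * f).ofConv x :=
  eq_of_forall_dual fun h ↦ by rw [apply_hitL, apply_hitL, apply_hitL, mul_assoc]

lemma hitR_hitR (f g : DualAlgebra K E) (x : E) :
    hitR f.ofConv (hitR g.ofConv x) = hitR (f * g).ofConv x :=
  eq_of_forall_dual fun h ↦ by rw [apply_hitR, apply_hitR, apply_hitR, mul_assoc]

lemma hitL_hitR (f g : DualAlgebra K E) (x : E) :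
    hitL f.ofConv (hitR g.ofConv x) = hitR g.ofConv (hitL f.ofConv x) :=
  eq_of_forall_dual fun h ↦ by rw [apply_hitL, apply_hitR, apply_hitR, apply_hitL, mul_assoc]

/-- A subspace stable under both actions of the dual algebra. -/
def IsHitStable (U : Submodule K E) : Prop :=
  ∀ f : E →ₗ[K] K, ∀ x ∈ U, hitL f x ∈ U ∧ hitR f x ∈ U

lemma IsHitStable.isSubcoalgebra {U : Submodule K E} (hU : IsHitStable U) :
    IsSubcoalgebra K E U := fun x hx ↦
  mem_range_map_subtype (fun f ↦ (hU f x hx).1) (fun f ↦ (hU f x hx).2)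

lemma isHitStable_of_isSubcoalgebra {U : Submodule K E} (hU : IsSubcoalgebra K E U) :
    IsHitStable U := by
  intro f x hx
  obtain ⟨z, hz⟩ := hU x hx
  simp only [hitL, hitR, LinearMap.coe_comp, Function.comp_apply, LinearEquiv.coe_coe, ← hz]
  clear hz
  induction z with
  | zero => simp
  | add a b ha hb => simp only [map_add]; exact ⟨add_mem ha.1 hb.1, add_mem ha.2 hb.2⟩
  | tmul a b =>
    simp only [map_tmul, LinearMap.rTensor_tmul, LinearMap.lTensor_tmul, lid_tmul, rid_tmul]
    exact ⟨U.smul_mem _ b.2, U.smul_mem _ a.2⟩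

/-- The subspace orthogonal to a left ideal of the dual algebra. -/
def perp (J : Ideal (DualAlgebra K E)) : Submodule K E where
  carrier := {x | ∀ f ∈ J, f.ofConv x = 0}
  add_mem' := fun ha hb f hf ↦ by rw [map_add, ha f hf, hb f hf, add_zero]
  zero_mem' := fun f _ ↦ map_zero _
  smul_mem' := fun c x hx f hf ↦ by rw [map_smul, hx f hf, smul_zero]

lemma isHitStable_perp (J : Ideal (DualAlgebra K E)) [J.IsTwoSided] : IsHitStable (perp J) := by
  refine fun f x hx ↦ ⟨fun g hg ↦ ?_, fun g hg ↦ ?_⟩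
  · exact (apply_hitL (toConv f) g x).trans (hx _ (J.mul_mem_left _ hg))
  · exact (apply_hitR g (toConv f) x).trans (hx _ (J.mul_mem_right _ hg))

/-- The ideal of functionals vanishing on a subcoalgebra. -/
def annIdeal (U : Submodule K E) (hU : IsHitStable U) : Ideal (DualAlgebra K E) where
  carrier := {f | ∀ x ∈ U, f.ofConv x = 0}
  add_mem' := fun {f g} ha hb x hx ↦ by
    change f.ofConv x + g.ofConv x = 0
    rw [ha x hx, hb x hx, add_zero]
  zero_mem' := fun _ _ ↦ rfl
  smul_mem' := fun c f hf x hx ↦ by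
    rw [smul_eq_mul, ← apply_hitL]
    exact hf _ (hU _ x hx).1

instance (U : Submodule K E) (hU : IsHitStable U) : (annIdeal U hU).IsTwoSided where
  mul_mem_of_left := fun {f} g hf x hx ↦ by
    rw [← apply_hitR]
    exact hf _ (hU _ x hx).2

/-- A point outside U is separated from U by a functional, so every subspace is closed on the
coalgebra side; on the dual side closedness has to be earned. -/
lemma perp_annIdeal (U : Submodule K E) (hU : IsHitStable U) : perp (annIdeal U hU) = U := by
  refine le_antisymm (fun x hx ↦ ?_) (fun x hx f hf ↦ hf x hx)
  by_contra hxU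
  obtain ⟨f, hf, hfU⟩ := U.exists_le_ker_of_notMem hxU
  exact hf (hx (toConv f) fun y hy ↦ LinearMap.mem_ker.mp (hfU hy))

/-- An ideal of the dual algebra that contains all functionals vanishing on a finite-dimensional
subspace is closed. -/
lemma mem_of_forall_perp {G : Submodule K E} [FiniteDimensional K G]
    {J : Ideal (DualAlgebra K E)} (hJ : ∀ f : DualAlgebra K E, (∀ x ∈ G, f.ofConv x = 0) → f ∈ J)
    {f : DualAlgebra K E} (hf : ∀ x ∈ perp J, f.ofConv x = 0) : f ∈ J := by
  let res : DualAlgebra K E →ₗ[K] Module.Dual K G :=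
    { toFun := fun g ↦ g.ofConv ∘ₗ G.subtype
      map_add' := fun _ _ ↦ rfl
      map_smul' := fun _ _ ↦ rfl }
  let W : Subspace K (Module.Dual K G) := (J.restrictScalars K).map res
  have : FiniteDimensional K (Module.Dual K G) := inferInstance
  have : FiniteDimensional K W := FiniteDimensional.finiteDimensional_submodule W
  -- Restricting to the finite-dimensional G, the image of J equals its double annihilator. Vectors
  -- of G killed by that image are exactly those of G lying in `perp J`, where f vanishes.
  have hW : res f ∈ W := by
    rw [← Subspace.dualCoannihilator_dualAnnihilator_eq (W := W), Submodule.mem_dualAnnihilator]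
    intro y hy
    exact hf y fun g hg ↦ (Submodule.mem_dualCoannihilator y).mp hy (res g) ⟨g, hg, rfl⟩
  obtain ⟨g, hg, hgf⟩ := hW
  -- The functional g in J agrees with f on G, so the difference vanishes on G and lies in J by
  -- hypothesis.
  have h1 : f - g ∈ J := hJ _ fun x hx ↦ by
    have := LinearMap.congr_fun hgf ⟨x, hx⟩
    change f.ofConv x - g.ofConv x = 0
    rw [sub_eq_zero]
    exact this.symm
  simpa using add_mem h1 hg

lemma exists_fg_forall_rTensor {M N : Type*} [AddCommGroup M] [Module K M]
    [AddCommGroup N] [Module K N] (z : M ⊗[K] N) : ∃ S : Submodule K N, S.FG ∧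
    ∀ f : M →ₗ[K] K, TensorProduct.lid K N (LinearMap.rTensor N f z) ∈ S := by
  induction z with
  | zero => exact ⟨⊥, Submodule.fg_bot, fun f ↦ by simp⟩
  | tmul a b =>
    refine ⟨Submodule.span K {b}, Submodule.fg_span_singleton b, fun f ↦ ?_⟩
    simpa using Submodule.smul_mem _ _ (Submodule.mem_span_singleton_self b)
  | add a b ha hb =>
    obtain ⟨S, hS, hS'⟩ := ha
    obtain ⟨T, hT, hT'⟩ := hb
    refine ⟨S ⊔ T, hS.sup hT, fun f ↦ ?_⟩
    rw [map_add, map_add]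
    exact add_mem (Submodule.mem_sup_left (hS' f)) (Submodule.mem_sup_right (hT' f))

lemma exists_fg_forall_lTensor {M N : Type*} [AddCommGroup M] [Module K M]
    [AddCommGroup N] [Module K N] (z : M ⊗[K] N) : ∃ S : Submodule K M, S.FG ∧
    ∀ f : N →ₗ[K] K, TensorProduct.rid K M (LinearMap.lTensor M f z) ∈ S := by
  induction z with
  | zero => exact ⟨⊥, Submodule.fg_bot, fun f ↦ by simp⟩
  | tmul a b =>
    refine ⟨Submodule.span K {a}, Submodule.fg_span_singleton a, fun f ↦ ?_⟩
    simpa using Submodule.smul_mem _ _ (Submodule.mem_span_singleton_self a)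
  | add a b ha hb =>
    obtain ⟨S, hS, hS'⟩ := ha
    obtain ⟨T, hT, hT'⟩ := hb
    refine ⟨S ⊔ T, hS.sup hT, fun f ↦ ?_⟩
    rw [map_add, map_add]
    exact add_mem (Submodule.mem_sup_left (hS' f)) (Submodule.mem_sup_right (hT' f))

/-- The fundamental theorem of coalgebras: every element lies in a finite-dimensional
subcoalgebra. -/
theorem exists_finiteDimensional_isHitStable (x : E) :
    ∃ G : Submodule K E, FiniteDimensional K G ∧ IsHitStable G ∧ x ∈ G := by
  let G : Submodule K E := Submodule.span K
    {y | ∃ f g : DualAlgebra K E, hitL f.ofConv (hitR g.ofConv x) = y}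
  refine ⟨G, ?_, ?_, ?_⟩
  · obtain ⟨T, ⟨t, rfl⟩, hT⟩ := exists_fg_forall_lTensor (comul (R := K) x)
    choose S hS hS' using fun y : E ↦ exists_fg_forall_rTensor (comul (R := K) y)
    have hfg : (⨆ y ∈ t, S y).FG := Submodule.fg_biSup t S fun y _ ↦ hS y
    have : FiniteDimensional K ↥(⨆ y ∈ t, S y) := Module.Finite.iff_fg.mpr hfg
    refine Submodule.finiteDimensional_of_le (S₂ := ⨆ y ∈ t, S y) (Submodule.span_le.mpr ?_)
    rintro _ ⟨f, g, rfl⟩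
    have hle : Submodule.span K (t : Set E) ≤ (⨆ y ∈ t, S y).comap (hitL f.ofConv) :=
      Submodule.span_le.mpr fun y hy ↦
        (le_iSup₂_of_le (f := fun y (_ : y ∈ t) ↦ S y) y hy le_rfl) (hS' y f.ofConv)
    exact hle (hT g.ofConv)
  · intro f y hy
    induction hy using Submodule.span_induction with
    | mem y hy =>
      obtain ⟨a, b, rfl⟩ := hy
      constructor
      · rw [show f = (toConv f).ofConv from rfl, hitL_hitL]
        exact Submodule.subset_span ⟨_, _, rfl⟩
      · rw [show f = (toConv f).ofConv from rfl, ← hitL_hitR, hitR_hitR]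
        exact Submodule.subset_span ⟨_, _, rfl⟩
    | zero => simp
    | add a b _ _ ha hb =>
      rw [map_add, map_add]
      exact ⟨add_mem ha.1 hb.1, add_mem ha.2 hb.2⟩
    | smul c a _ ha =>
      rw [map_smul, map_smul]
      exact ⟨G.smul_mem c ha.1, G.smul_mem c ha.2⟩
  · refine Submodule.subset_span ⟨toConv counit, toConv counit, ?_⟩
    simp [hitL, hitR]

/-- A finite-codimensional maximal two-sided ideal of the dual algebra is orthogonal to a simple
subcoalgebra. -/
lemma isSimpleSubcoalgebra_perp {G : Submodule K E} [FiniteDimensional K G]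
    {J : Ideal (DualAlgebra K E)} [J.IsTwoSided]
    (hJ : ∀ f : DualAlgebra K E, (∀ x ∈ G, f.ofConv x = 0) → f ∈ J) (htop : J ≠ ⊤)
    (hmax : ∀ J' : Ideal (DualAlgebra K E), J'.IsTwoSided → J ≤ J' → J' = J ∨ J' = ⊤) :
    IsSimpleSubcoalgebra K E (perp J) := by
  refine ⟨(isHitStable_perp J).isSubcoalgebra, fun h ↦ htop ?_, fun D hD hDs ↦ ?_⟩
  -- If `perp J` were zero, the closedness of J would put every functional in J.
  · rw [eq_top_iff]
    refine fun f _ ↦ mem_of_forall_perp hJ fun x hx ↦ ?_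
    rw [h, Submodule.mem_bot] at hx
    rw [hx, map_zero]
  · have hst := isHitStable_of_isSubcoalgebra hDs
    rcases hmax (annIdeal D hst) inferInstance (fun f hf x hx ↦ hD hx f hf) with h | h
    · right; rw [← h, perp_annIdeal]
    · left
      rw [← perp_annIdeal D hst, h, Submodule.eq_bot_iff]
      intro x hx
      exact eq_of_forall_dual fun f ↦ by rw [hx f Submodule.mem_top, map_zero]

/-- The wedge `U ∧ U` of a subcoalgebra with itself. -/
def wedge (U : Submodule K E) (hU : IsHitStable U) : Submodule K E :=
  perp (annIdeal U hU * annIdeal U hU)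

lemma isHitStable_wedge (U : Submodule K E) (hU : IsHitStable U) : IsHitStable (wedge U hU) :=
  isHitStable_perp _

/-- The iterated wedge powers of a subcoalgebra. -/
def wedgeSeq (U : Submodule K E) (hU : IsHitStable U) : ℕ → {V : Submodule K E // IsHitStable V}
  | 0 => ⟨U, hU⟩
  | n + 1 => ⟨wedge (wedgeSeq U hU n).1 (wedgeSeq U hU n).2, isHitStable_wedge _ _⟩

lemma le_wedge (U : Submodule K E) (hU : IsHitStable U) : U ≤ wedge U hU :=
  fun x hx _ hf ↦ Ideal.mul_le_left hf x hx

/-- A coalgebra is the union of the wedge powers of any subcoalgebra containing the coradical. -/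
theorem exists_mem_wedgeSeq (U : Submodule K E) (hU : IsHitStable U)
    (hcorad : coradical K E ≤ U) (x : E) : ∃ n, x ∈ (wedgeSeq U hU n).1 := by
  obtain ⟨G, hGf, hG, hx⟩ := exists_finiteDimensional_isHitStable (K := K) x
  let N := annIdeal G hG
  let P := annIdeal U hU
  have : IsArtinianRing (DualAlgebra K E ⧸ N) := by
    let res : DualAlgebra K E →ₗ[K] Module.Dual K G :=
      { toFun := fun g ↦ g.ofConv ∘ₗ G.subtype
        map_add' := fun _ _ ↦ rfl
        map_smul' := fun _ _ ↦ rfl }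
    have hker : LinearMap.ker res = N.restrictScalars K := by
      ext f
      refine ⟨fun h y hy ↦ LinearMap.congr_fun (LinearMap.mem_ker.mp h) ⟨y, hy⟩, fun h ↦ ?_⟩
      exact LinearMap.mem_ker.mpr (LinearMap.ext fun y ↦ h y.1 y.2)
    have hfin : Module.Finite K (DualAlgebra K E ⧸ N.restrictScalars K) := by
      rw [← hker]
      exact Module.Finite.equiv res.quotKerEquivRange.symm
    have hfin' : Module.Finite K (DualAlgebra K E ⧸ N) :=
      Module.Finite.equiv (Submodule.Quotient.restrictScalarsEquiv K N)
    exact IsArtinianRing.of_finite K _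
  -- Otherwise some maximal ideal J above N does not contain P. Its orthogonal is a simple
  -- subcoalgebra, hence lies in the coradical and so in U; functionals vanishing on U then vanish
  -- on `perp J` and lie in the closed ideal J, contradicting the choice of J.
  have hpow : ∃ m : ℕ, P ^ m ≤ N := by
    by_contra! hP
    obtain ⟨J, hJ, hNJ, htop, hPJ, hmax⟩ := exists_maximal_twoSided N P hP
    have hs := isSimpleSubcoalgebra_perp (G := G) (fun f hf ↦ hNJ hf) htop hmax
    have hle : perp J ≤ U := le_trans (le_sSup hs) hcorad
    exact hPJ fun f hf ↦ mem_of_forall_perp (G := G) (fun g hg ↦ hNJ hg) fun y hy ↦ hf y (hle hy)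
  -- Each wedge squares the annihilator, up to closure, which explains the exponent 2ⁿ. Adding N
  -- makes the right-hand side contain all functionals vanishing on G, so it is closed and absorbs
  -- the closure.
  have hann (n : ℕ) : annIdeal (wedgeSeq U hU n).1 (wedgeSeq U hU n).2 ≤ P ^ (2 ^ n) ⊔ N := by
    induction n with
    | zero =>
      rw [pow_zero, Submodule.pow_one]
      exact le_sup_left (a := P)
    | succ n ih =>
      set I := annIdeal (wedgeSeq U hU n).1 (wedgeSeq U hU n).2
      have hmul : I * I ≤ P ^ (2 ^ (n + 1)) ⊔ N := by
        rw [Ideal.mul_le]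
        intro a ha b hb
        obtain ⟨a₁, ha₁, a₂, ha₂, rfl⟩ := Submodule.mem_sup.mp (ih ha)
        obtain ⟨b₁, hb₁, b₂, hb₂, rfl⟩ := Submodule.mem_sup.mp (ih hb)
        rw [add_mul, mul_add, add_assoc]
        refine add_mem (Submodule.mem_sup_left ?_) (Submodule.mem_sup_right
          (add_mem (N.mul_mem_left _ hb₂) (N.mul_mem_right _ ha₂)))
        rw [pow_succ, mul_two, Ideal.IsTwoSided.pow_add]
        exact Ideal.mul_mem_mul ha₁ hb₁
      intro f hf
      refine mem_of_forall_perp (G := G) (fun g hg ↦ ?_) fun y hy ↦ ?_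
      · exact Submodule.mem_sup_right (show g ∈ N from hg)
      · exact hf y fun g hg ↦ hy g (hmul hg)
  obtain ⟨m, hm⟩ := hpow
  refine ⟨m, ?_⟩
  rw [← perp_annIdeal (wedgeSeq U hU m).1 (wedgeSeq U hU m).2]
  intro f hf
  -- Since m < 2ᵐ, the m-th wedge stage already has its annihilator inside that of G, so x belongs
  -- to it.
  have h1 : P ^ (2 ^ m) ⊔ N ≤ N :=
    sup_le ((Ideal.pow_le_pow_right m.lt_two_pow_self.le).trans hm) le_rfl
  exact h1 (hann m hf) x hx

end DualAlgebra


/-! ### Convergence of the Newton iteration along the wedge filtration -/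

section Convergence

variable {K : Type u} [Field K] {E : Type w} [AddCommGroup E] [Module K E] [Coalgebra K E]
  {M N : Type*} [AddCommGroup M] [Module K M] [AddCommGroup N] [Module K N]

/-- Slicing the second factor with b gives f evaluated at x₁ b(g(x₂)), which stays in the stable
subspace D. -/
lemma tconv_apply_eq_zero {D : Submodule K E} (hD : IsHitStable D) {f : E →ₗ[K] M}
    (hf : ∀ x ∈ D, f x = 0) (g : E →ₗ[K] N) {x : E} (hx : x ∈ D) : tconv f g x = 0 := by
  refine eq_zero_of_forall_lTensor fun b ↦ ?_
  rw [← hf _ (hD (b ∘ₗ g) x hx).2]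
  simp only [tconv, hitR, LinearMap.coe_comp, Function.comp_apply, LinearEquiv.coe_coe]
  generalize comul (R := K) x = z
  induction z with
  | zero => simp
  | add a b ha hb => simp_all
  | tmul a b => simp

/-- Pairing with a ⊗ b yields the product of a ∘ f and b ∘ g in the dual algebra, which lies in the
square of the annihilator of D. -/
lemma tconv_apply_eq_zero_of_mem_wedge {D : Submodule K E} (hD : IsHitStable D) {f : E →ₗ[K] M}
    {g : E →ₗ[K] N} (hf : ∀ x ∈ D, f x = 0) (hg : ∀ x ∈ D, g x = 0) {x : E}
    (hx : x ∈ wedge D hD) : tconv f g x = 0 := by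
  refine eq_zero_of_forall_map fun a b ↦ ?_
  have ha : toConv (a ∘ₗ f) ∈ annIdeal D hD := fun y hy ↦ by simp [hf y hy]
  have hb : toConv (b ∘ₗ g) ∈ annIdeal D hD := fun y hy ↦ by simp [hg y hy]
  rw [← hx _ (Ideal.mul_mem_mul ha hb)]
  simp only [tconv, LinearMap.coe_comp, Function.comp_apply, LinearMap.convMul_apply]
  generalize comul (R := K) x = z
  induction z with
  | zero => simp
  | add a b ha hb => simp_all
  | tmul a b => simp

variable {C : Type v} [AddCommGroup C] [Module K C] [Coalgebra K C]
  {η : C ⊗[K] (C ⊗[K] C) →ₗ[K] C}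

lemma newtonCorrection_apply_eq_zero {D : Submodule K E} (hD : IsHitStable D) {σ : E →ₗ[K] C}
    (hσD : ∀ x ∈ D, comulDefect σ x = 0) {x : E} (hx : x ∈ D) : newtonCorrection η σ x = 0 := by
  rw [newtonCorrection, LinearMap.comp_apply, LinearMap.comp_apply,
    tconv_apply_eq_zero hD hσD σ hx, map_zero, map_zero]

/-- All three terms of the new defect are built from convolutions of two maps vanishing on D, namely
φ∗φ twice and κ∗κ. -/
lemma comulDefect_newton_apply_eq_zero (hη : IsSmoothing η) {D : Submodule K E}
    (hD : IsHitStable D) {σ : E →ₗ[K] C} (hσ : counit ∘ₗ σ = (counit : E →ₗ[K] K))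
    (hσD : ∀ x ∈ D, comulDefect σ x = 0) {x : E} (hx : x ∈ wedge D hD) :
    comulDefect (newton η σ) x = 0 := by
  have h1 := tconv_apply_eq_zero_of_mem_wedge hD hσD hσD hx
  have h2 : tconv (newtonCorrection η σ) (newtonCorrection η σ) x = 0 :=
    tconv_apply_eq_zero_of_mem_wedge hD (fun y hy ↦ newtonCorrection_apply_eq_zero hD hσD hy)
      (fun y hy ↦ newtonCorrection_apply_eq_zero hD hσD hy) hx
  rw [comulDefect_newton hη hσ]
  simp [h1, h2]

/-- The Newton iteration started at a counital linear retraction of a subcoalgebra containing the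
coradical becomes locally constant, with limit a coalgebra retraction. -/
theorem exists_coalgHom_eventually_eq_newton (hη : IsSmoothing η) (ι : C →ₗc[K] E)
    (hcorad : coradical K E ≤ LinearMap.range ι.toLinearMap) (σ : E →ₗ[K] C)
    (hσ : counit ∘ₗ σ = (counit : E →ₗ[K] K)) (hσι : ∀ c, σ (ι c) = c) :
    ∃ π : E →ₗc[K] C, (∀ c, π (ι c) = c) ∧
      ∀ x, ∃ n, ∀ m ≥ n, ((newton η)^[m] σ) x = π x := by
  let U : Submodule K E := LinearMap.range ι.toLinearMap
  have hι (c : C) : comul (R := K) (ι c) = map ι.toLinearMap ι.toLinearMap (comul c) :=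
    (LinearMap.congr_fun ι.map_comp_comul c).symm
  have hU : IsHitStable U := isHitStable_of_isSubcoalgebra <| by
    rintro _ ⟨c, rfl⟩
    change comul (R := K) (ι c) ∈ _
    rw [hι]
    refine ⟨map ι.toLinearMap.rangeRestrict ι.toLinearMap.rangeRestrict (comul c), ?_⟩
    rw [← LinearMap.comp_apply, ← map_comp]
    rfl
  let s (n : ℕ) : E →ₗ[K] C := (newton η)^[n] σ
  have hs (n : ℕ) : s (n + 1) = newton η (s n) := Function.iterate_succ_apply' _ _ _
  let D (n : ℕ) : Submodule K E := (wedgeSeq U hU n).1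
  have hD (n : ℕ) : IsHitStable (D n) := (wedgeSeq U hU n).2
  have hcounit (n : ℕ) : counit ∘ₗ s n = (counit : E →ₗ[K] K) := by
    induction n with
    | zero => exact hσ
    | succ n ih => rw [hs]; exact counit_comp_newton hη ih
  -- At the start, σ is inverse to the coalgebra map ι on its image, so its defect vanishes there;
  -- each step then extends the vanishing to the next wedge.
  have hdef (n : ℕ) : ∀ x ∈ D n, comulDefect (s n) x = 0 := by
    induction n with
    | zero =>
      rintro _ ⟨c, rfl⟩
      change comul (R := K) (σ (ι c)) - map σ σ (comul (ι c)) = 0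
      have : σ ∘ₗ ι.toLinearMap = LinearMap.id := LinearMap.ext hσι
      rw [hσι, hι, ← LinearMap.comp_apply, ← map_comp, this, map_id, LinearMap.id_apply, sub_self]
    | succ n ih =>
      intro x hx
      rw [hs]
      exact comulDefect_newton_apply_eq_zero hη (hD n) (hcounit n) ih hx
  have hmono : Monotone D := monotone_nat_of_le_succ fun n ↦ le_wedge _ _
  -- Where the defect already vanishes the correction does too, so later iterates do not change on D
  -- n.
  have hstab (n m : ℕ) (hnm : n ≤ m) (x : E) (hx : x ∈ D n) : s m x = s n x := by
    induction m, hnm using Nat.le_induction with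
    | base => rfl
    | succ m hm ih =>
      rw [hs, newton, LinearMap.sub_apply,
        newtonCorrection_apply_eq_zero (hD m) (hdef m) (hmono hm hx), sub_zero, ih]
  choose d hd using exists_mem_wedgeSeq U hU hcorad
  have hlim (n : ℕ) (x : E) (hx : x ∈ D n) : s (d x) x = s n x := by
    rcases le_total (d x) n with h | h
    · exact (hstab _ _ h x (hd x)).symm
    · exact hstab _ _ h x hx
  let π : E →ₗ[K] C :=
    { toFun := fun x ↦ s (d x) x
      map_add' := fun x y ↦ by
        have hx := hmono (le_max_left (d x) (d y)) (hd x)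
        have hy := hmono (le_max_right (d x) (d y)) (hd y)
        rw [hlim _ _ (add_mem hx hy), hlim _ _ hx, hlim _ _ hy, map_add]
      map_smul' := fun c x ↦ by
        rw [hlim _ _ ((D (d x)).smul_mem c (hd x)), map_smul, RingHom.id_apply] }
  have hπ (n : ℕ) (x : E) (hx : x ∈ D n) : π x = s n x := hlim n x hx
  -- As D n is a subcoalgebra, the coproduct of x only involves points where the limit equals the
  -- single iterate s n.
  have hπmap (n : ℕ) (x : E) (hx : x ∈ D n) :
      map π π (comul (R := K) x) = map (s n) (s n) (comul x) := by
    obtain ⟨z, hz⟩ := (hD n).isSubcoalgebra x hx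
    have : π ∘ₗ (D n).subtype = s n ∘ₗ (D n).subtype := LinearMap.ext fun y ↦ hπ n y y.2
    rw [← hz, ← LinearMap.comp_apply, ← LinearMap.comp_apply, ← map_comp, ← map_comp, this]
  refine ⟨{ π with
    counit_comp := LinearMap.ext fun x ↦ LinearMap.congr_fun (hcounit (d x)) x
    map_comp_comul := LinearMap.ext fun x ↦ ?_ }, fun c ↦ ?_, fun x ↦ ⟨d x, fun m hm ↦ ?_⟩⟩
  · have := hdef (d x) x (hd x)
    rw [comulDefect, LinearMap.sub_apply, sub_eq_zero] at this
    exact (hπmap _ x (hd x)).trans this.symm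
  · exact (hπ 0 (ι c) ⟨c, rfl⟩).trans (hσι c)
  · exact (hπ m x (hmono hm (hd x))).symm

end Convergence


/-! ### Operators indexed by H and equivariant maps -/

section Actions

variable {K : Type u} {H : Type v} [Field K] [Ring H] [Bialgebra K H]
  {M N P M' N' : Type*} [AddCommGroup M] [Module K M] [AddCommGroup N] [Module K N]
  [AddCommGroup P] [Module K P] [AddCommGroup M'] [Module K M'] [AddCommGroup N'] [Module K N']

/-- The diagonal operators on a tensor product of two spaces with operators indexed by `H`. -/
def diagAct (ρ : H →ₗ[K] Module.End K M) (τ : H →ₗ[K] Module.End K N) :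
    H →ₗ[K] Module.End K (M ⊗[K] N) :=
  homTensorHomMap (RingHom.id K) M N M N ∘ₗ map ρ τ ∘ₗ comul

/-- The orbit map of x ⊗ y is the convolution of the orbit maps of x and y, so equivariance
questions reduce to identities in the coalgebra H. -/
lemma diagAct_tmul (ρ : H →ₗ[K] Module.End K M) (τ : H →ₗ[K] Module.End K N) (h : H) (x : M)
    (y : N) : diagAct ρ τ h (x ⊗ₜ y) = map (ρ.flip x) (τ.flip y) (comul h) := by
  simp only [diagAct, LinearMap.coe_comp, Function.comp_apply]
  generalize comul (R := K) h = z
  induction z with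
  | zero => simp
  | add a b ha hb => simp only [map_add, LinearMap.add_apply, ha, hb]
  | tmul a b => simp

/-- The trivial operators on the ground field. -/
def trivAct (K : Type u) (H : Type v) [Field K] [Ring H] [Bialgebra K H] :
    H →ₗ[K] Module.End K K :=
  (LinearMap.lsmul K K : K →ₗ[K] Module.End K K) ∘ₗ counit

lemma trivAct_apply (h : H) (c : K) : trivAct K H h c = counit (R := K) h * c := rfl

/-- A linear map that commutes with the operators indexed by `H`. -/
def IsEquivariant (ρ : H →ₗ[K] Module.End K M) (τ : H →ₗ[K] Module.End K N) (f : M →ₗ[K] N) :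
    Prop :=
  ∀ h x, f (ρ h x) = τ h (f x)

section Equivariance

variable {ρ : H →ₗ[K] Module.End K M} {τ : H →ₗ[K] Module.End K N} {υ : H →ₗ[K] Module.End K P}
  {ρ' : H →ₗ[K] Module.End K M'} {τ' : H →ₗ[K] Module.End K N'}

lemma IsEquivariant.comp {g : N →ₗ[K] P} {f : M →ₗ[K] N} (hg : IsEquivariant τ υ g)
    (hf : IsEquivariant ρ τ f) : IsEquivariant ρ υ (g ∘ₗ f) := fun h x ↦ by
  rw [LinearMap.comp_apply, hf, hg, LinearMap.comp_apply]

lemma IsEquivariant.sub {f g : M →ₗ[K] N} (hf : IsEquivariant ρ τ f)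
    (hg : IsEquivariant ρ τ g) : IsEquivariant ρ τ (f - g) := fun h x ↦ by
  simp [hf h x, hg h x]

lemma IsEquivariant.map {f : M →ₗ[K] M'} {g : N →ₗ[K] N'} (hf : IsEquivariant ρ ρ' f)
    (hg : IsEquivariant τ τ' g) :
    IsEquivariant (diagAct ρ τ) (diagAct ρ' τ') (TensorProduct.map f g) := fun h z ↦ by
  induction z with
  | zero => simp
  | add a b ha hb => simp only [map_add, ha, hb]
  | tmul x y =>
    have h1 : ρ'.flip (f x) = f ∘ₗ ρ.flip x := LinearMap.ext fun h ↦ (hf h x).symm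
    have h2 : τ'.flip (g y) = g ∘ₗ τ.flip y := LinearMap.ext fun h ↦ (hg h y).symm
    rw [map_tmul, diagAct_tmul, diagAct_tmul, h1, h2, TensorProduct.map_comp,
      LinearMap.comp_apply]

/-- Coassociativity of H, applied to the orbit maps of the three factors. -/
lemma isEquivariant_assoc : IsEquivariant (diagAct (diagAct ρ τ) υ) (diagAct ρ (diagAct τ υ))
    (TensorProduct.assoc K M N P).toLinearMap := fun h w ↦ by
  suffices hs : (TensorProduct.assoc K M N P).toLinearMap ∘ₗ diagAct (diagAct ρ τ) υ h
      = diagAct ρ (diagAct τ υ) h ∘ₗ (TensorProduct.assoc K M N P).toLinearMap from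
    LinearMap.congr_fun hs w
  ext x y z
  have h1 : (diagAct ρ τ).flip (x ⊗ₜ y) = tconv (ρ.flip x) (τ.flip y) :=
    LinearMap.ext fun h ↦ diagAct_tmul ρ τ h x y
  have h2 : (diagAct τ υ).flip (y ⊗ₜ z) = tconv (τ.flip y) (υ.flip z) :=
    LinearMap.ext fun h ↦ diagAct_tmul τ υ h y z
  have h3 := LinearMap.congr_fun (assoc_comp_tconv (ρ.flip x) (τ.flip y) (υ.flip z)) h
  simpa [diagAct_tmul, h1, h2, tconv] using h3

lemma isEquivariant_assoc_symm :
    IsEquivariant (diagAct ρ (diagAct τ υ)) (diagAct (diagAct ρ τ) υ)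
    (TensorProduct.assoc K M N P).symm.toLinearMap := fun h w ↦ by
  have := isEquivariant_assoc (ρ := ρ) (τ := τ) (υ := υ) h ((TensorProduct.assoc K M N P).symm w)
  simp only [LinearEquiv.coe_coe, LinearEquiv.apply_symm_apply] at this ⊢
  rw [← this, LinearEquiv.symm_apply_apply]

lemma isEquivariant_rid : IsEquivariant (diagAct ρ (trivAct K H)) ρ
    (TensorProduct.rid K M).toLinearMap := fun h w ↦ by
  induction w with
  | zero => simp
  | add a b ha hb => simp only [map_add, ha, hb]
  | tmul x c =>
    have key : ∀ z : H ⊗[K] H, TensorProduct.rid K M (TensorProduct.map (ρ.flip x)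
        ((trivAct K H).flip c) z)
        = c • ρ (TensorProduct.rid K H (LinearMap.lTensor H counit z)) x := by
      intro z
      induction z with
      | zero => simp
      | add a b ha hb => simp only [map_add, ha, hb, LinearMap.add_apply, smul_add]
      | tmul a b => simp [trivAct_apply, mul_comm, mul_smul]
    simp [diagAct_tmul, key]

lemma isEquivariant_lid : IsEquivariant (diagAct (trivAct K H) ρ) ρ
    (TensorProduct.lid K M).toLinearMap := fun h w ↦ by
  induction w with
  | zero => simp
  | add a b ha hb => simp only [map_add, ha, hb]
  | tmul c x =>
    have key : ∀ z : H ⊗[K] H, TensorProduct.lid K M (TensorProduct.map ((trivAct K H).flip c)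
        (ρ.flip x) z)
        = c • ρ (TensorProduct.lid K H (LinearMap.rTensor H counit z)) x := by
      intro z
      induction z with
      | zero => simp
      | add a b ha hb => simp only [map_add, ha, hb, LinearMap.add_apply, smul_add]
      | tmul a b => simp [trivAct_apply, mul_comm, mul_smul]
    simp [diagAct_tmul, key]

end Equivariance

section Newton

/-- A coalgebra with operators indexed by `H` for which the structure maps are equivariant. -/
structure IsActedCoalgebra {E : Type*} [AddCommGroup E] [Module K E] [Coalgebra K E]
    (ρ : H →ₗ[K] Module.End K E) : Prop where
  comul : IsEquivariant ρ (diagAct ρ ρ) (comul (R := K) (A := E))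
  counit : IsEquivariant ρ (trivAct K H) (counit (R := K) (A := E))

variable {E : Type*} [AddCommGroup E] [Module K E] [Coalgebra K E] {ρ : H →ₗ[K] Module.End K E}
  {ρ' : H →ₗ[K] Module.End K M'} {τ' : H →ₗ[K] Module.End K N'}

lemma IsEquivariant.tconv (hρ : IsActedCoalgebra ρ) {f : E →ₗ[K] M'} {g : E →ₗ[K] N'}
    (hf : IsEquivariant ρ ρ' f) (hg : IsEquivariant ρ τ' g) :
    IsEquivariant ρ (diagAct ρ' τ') (tconv f g) :=
  (hf.map hg).comp hρ.comul

lemma IsEquivariant.newton {C : Type*} [AddCommGroup C] [Module K C] [Coalgebra K C]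
    {τ : H →ₗ[K] Module.End K C} (hρ : IsActedCoalgebra ρ) (hτ : IsActedCoalgebra τ)
    {η : C ⊗[K] (C ⊗[K] C) →ₗ[K] C} (hη : IsEquivariant (diagAct τ (diagAct τ τ)) τ η)
    {σ : E →ₗ[K] C} (hσ : IsEquivariant ρ τ σ) : IsEquivariant ρ τ (newton η σ) :=
  hσ.sub (hη.comp (isEquivariant_assoc.comp
    (((hτ.comul.comp hσ).sub (hσ.tconv hρ hσ)).tconv hρ hσ)))

end Newton

/-! ### Averaging linear maps over a separability element -/

section Averaging

/-- The operators `ρ` form an action with respect to the multiplication `μ`. -/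
structure IsAction (μ : H →ₗ[K] H →ₗ[K] H) (ρ : H →ₗ[K] Module.End K M) : Prop where
  mul : ∀ a b x, ρ (μ a b) x = ρ a (ρ b x)
  one : ∀ x, ρ 1 x = x

/-- A multiplication on `H` with respect to which counit and comultiplication are
multiplicative. -/
structure IsComultiplicative (μ : H →ₗ[K] H →ₗ[K] H) : Prop where
  comul : ∀ a b, comul (R := K) (μ a b) = map₂ μ μ (comul a) (comul b)
  counit : ∀ a b, counit (R := K) (μ a b) = counit (R := K) a * counit (R := K) b

/-- A separability element `e = ∑ a ⊗ b` for the multiplication `μ` that satisfies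
`b₁ a₁ ⊗ a₂ ⊗ b₂ = 1 ⊗ a ⊗ b` and `a₁ ⊗ b₁ ⊗ b₂ a₂ = a ⊗ b ⊗ 1`. -/
structure IsAveraging (μ : H →ₗ[K] H →ₗ[K] H) (e : H ⊗[K] H) : Prop where
  central : ∀ h, LinearMap.rTensor H (μ.flip h) e = LinearMap.lTensor H (μ h) e
  unit : lift μ.flip e = 1
  left : LinearMap.rTensor (H ⊗[K] H) (lift μ.flip)
    (tensorTensorTensorComm K H H H H (map comul comul e)) = 1 ⊗ₜ e
  right : LinearMap.lTensor (H ⊗[K] H) (lift μ.flip)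
    (tensorTensorTensorComm K H H H H (map comul comul e)) = e ⊗ₜ 1

variable {μ : H →ₗ[K] H →ₗ[K] H}

lemma IsAction.triv (hμ : IsComultiplicative μ) : IsAction μ (trivAct K H) where
  mul a b x := by simp [trivAct_apply, hμ.counit, mul_assoc]
  one x := by simp [trivAct_apply]

lemma IsAction.diag (hμ : IsComultiplicative μ) {ρ : H →ₗ[K] Module.End K M}
    {τ : H →ₗ[K] Module.End K N} (hρ : IsAction μ ρ) (hτ : IsAction μ τ) :
    IsAction μ (diagAct ρ τ) where
  mul a b w := by
    have key : ∀ z w : H ⊗[K] H, homTensorHomMap (RingHom.id K) M N M N (map ρ τ (map₂ μ μ z w))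
        = homTensorHomMap (RingHom.id K) M N M N (map ρ τ z) ∘ₗ
          homTensorHomMap (RingHom.id K) M N M N (map ρ τ w) := by
      intro z w
      induction z with
      | zero => simp
      | add a b ha hb => simp only [map_add, LinearMap.add_apply, LinearMap.add_comp, ha, hb]
      | tmul a b =>
        induction w with
        | zero => simp
        | add a b ha hb => simp only [map_add, LinearMap.comp_add, ha, hb]
        | tmul c d =>
          ext x y
          simp [hρ.mul, hτ.mul]
    change homTensorHomMap (RingHom.id K) M N M N (map ρ τ (comul (μ a b))) w = _
    rw [hμ.comul, key]
    rfl
  one w := by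
    induction w with
    | zero => simp
    | add a b ha hb => simp only [map_add, ha, hb]
    | tmul x y =>
      rw [diagAct_tmul, Bialgebra.comul_one]
      simp [Algebra.TensorProduct.one_def, hρ.one, hτ.one]

/-- The bilinear family `a ⊗ b ↦ τ(b) ∘ f ∘ ρ(a)`. -/
def sandwich (ρ : H →ₗ[K] Module.End K M) (τ : H →ₗ[K] Module.End K N) (f : M →ₗ[K] N) :
    H ⊗[K] H →ₗ[K] M →ₗ[K] N :=
  lift (LinearMap.mk₂ K (fun a b ↦ τ b ∘ₗ f ∘ₗ ρ a)
    (fun a a' b ↦ by simp [LinearMap.comp_add])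
    (fun c a b ↦ by simp [LinearMap.comp_smul])
    (fun a b b' ↦ by simp [LinearMap.add_comp])
    (fun c a b ↦ by simp [LinearMap.smul_comp]))

@[simp]
lemma sandwich_tmul (ρ : H →ₗ[K] Module.End K M) (τ : H →ₗ[K] Module.End K N) (f : M →ₗ[K] N)
    (a b : H) (x : M) : sandwich ρ τ f (a ⊗ₜ b) x = τ b (f (ρ a x)) := rfl

variable {ρ : H →ₗ[K] Module.End K M} {τ : H →ₗ[K] Module.End K N} {υ : H →ₗ[K] Module.End K P}

lemma sandwich_sub (f g : M →ₗ[K] N) (e : H ⊗[K] H) :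
    sandwich ρ τ (f - g) e = sandwich ρ τ f e - sandwich ρ τ g e := by
  induction e with
  | zero => simp
  | add a b ha hb => simp only [map_add, ha, hb]; abel
  | tmul a b => ext x; simp

lemma sandwich_add (f g : M →ₗ[K] N) (e : H ⊗[K] H) :
    sandwich ρ τ (f + g) e = sandwich ρ τ f e + sandwich ρ τ g e := by
  induction e with
  | zero => simp
  | add a b ha hb => simp only [map_add, ha, hb]; abel
  | tmul a b => ext x; simp

lemma sandwich_comp {u : P →ₗ[K] M} (hu : IsEquivariant υ ρ u) (f : M →ₗ[K] N) (e : H ⊗[K] H) :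
    sandwich ρ τ f e ∘ₗ u = sandwich υ τ (f ∘ₗ u) e := by
  induction e with
  | zero => simp
  | add a b ha hb => simp only [map_add, LinearMap.add_comp, ha, hb]
  | tmul a b => ext x; simp [hu a x]

lemma comp_sandwich {u : N →ₗ[K] P} (hu : IsEquivariant τ υ u) (f : M →ₗ[K] N) (e : H ⊗[K] H) :
    u ∘ₗ sandwich ρ τ f e = sandwich ρ υ (u ∘ₗ f) e := by
  induction e with
  | zero => simp
  | add a b ha hb => simp only [map_add, LinearMap.comp_add, ha, hb]
  | tmul a b => ext x; simp [hu b]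

/-- Equivariance moves ρ(a) across f, leaving the operator of Σ μ(b, a) = 1. -/
lemma IsAveraging.sandwich_of_isEquivariant {e : H ⊗[K] H} (he : IsAveraging μ e)
    (hτ : IsAction μ τ) {f : M →ₗ[K] N} (hf : IsEquivariant ρ τ f) : sandwich ρ τ f e = f := by
  have key : ∀ z : H ⊗[K] H, sandwich ρ τ f z = τ (lift μ.flip z) ∘ₗ f := by
    intro z
    induction z with
    | zero => simp
    | add a b ha hb => simp only [map_add, LinearMap.add_comp, ha, hb]
    | tmul a b => ext x; simp [hf a x, hτ.mul]
  rw [key, he.unit]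
  ext x
  exact hτ.one _

/-- Precomposing with ρ(h) multiplies the first leg of e, which `central` transfers to the second
leg, where it acts as τ(h). -/
lemma IsAveraging.isEquivariant_sandwich {e : H ⊗[K] H} (he : IsAveraging μ e)
    (hρ : IsAction μ ρ) (hτ : IsAction μ τ) (f : M →ₗ[K] N) :
    IsEquivariant ρ τ (sandwich ρ τ f e) := by
  intro h x
  have h1 : ∀ z : H ⊗[K] H, sandwich ρ τ f (LinearMap.rTensor H (μ.flip h) z) x
      = sandwich ρ τ f z (ρ h x) := by
    intro z
    induction z with
    | zero => simp
    | add a b ha hb => simp only [map_add, LinearMap.add_apply, ha, hb]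
    | tmul a b => simp [hρ.mul]
  have h2 : ∀ z : H ⊗[K] H, sandwich ρ τ f (LinearMap.lTensor H (μ h) z) x
      = τ h (sandwich ρ τ f z x) := by
    intro z
    induction z with
    | zero => simp
    | add a b ha hb => simp only [map_add, LinearMap.add_apply, ha, hb]
    | tmul a b => simp [hτ.mul]
  rw [← h1, ← h2, he.central]

/-- Averaging preserves equivariance for a commuting family of operators. -/
lemma IsEquivariant.sandwich {ρ' : H →ₗ[K] Module.End K M} {τ' : H →ₗ[K] Module.End K N}
    (hρ : ∀ a b x, ρ a (ρ' b x) = ρ' b (ρ a x)) (hτ : ∀ a b x, τ a (τ' b x) = τ' b (τ a x))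
    {f : M →ₗ[K] N} (hf : IsEquivariant ρ' τ' f) (e : H ⊗[K] H) :
    IsEquivariant ρ' τ' (sandwich ρ τ f e) := by
  intro h x
  induction e with
  | zero => simp
  | add a b ha hb => simp only [map_add, LinearMap.add_apply, ha, hb]
  | tmul a b => simp [hρ, hτ, hf h]

lemma diagAct_commute {ρ ρ' : H →ₗ[K] Module.End K M} {τ τ' : H →ₗ[K] Module.End K N}
    (hρ : ∀ a b x, ρ a (ρ' b x) = ρ' b (ρ a x)) (hτ : ∀ a b x, τ a (τ' b x) = τ' b (τ a x))
    (a b : H) (x : M ⊗[K] N) :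
    diagAct ρ τ a (diagAct ρ' τ' b x) = diagAct ρ' τ' b (diagAct ρ τ a x) := by
  have key : ∀ z w : H ⊗[K] H, homTensorHomMap (RingHom.id K) M N M N (map ρ τ z) ∘ₗ
          homTensorHomMap (RingHom.id K) M N M N (map ρ' τ' w)
        = homTensorHomMap (RingHom.id K) M N M N (map ρ' τ' w) ∘ₗ
          homTensorHomMap (RingHom.id K) M N M N (map ρ τ z) := by
    intro z w
    induction z with
    | zero => simp
    | add a b ha hb => simp only [map_add, LinearMap.comp_add, LinearMap.add_comp, ha, hb]
    | tmul a b =>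
      induction w with
      | zero => simp
      | add a b ha hb => simp only [map_add, LinearMap.comp_add, LinearMap.add_comp, ha, hb]
      | tmul c d => ext x y; simp [hρ, hτ]
  exact LinearMap.congr_fun (key (comul a) (comul b)) x

/-- On the idle factor the diagonal actions combine to b₁a₁, which the condition `left` replaces by
1. This and its mirror image let the averaged map remain a coderivation. -/
lemma IsAveraging.sandwich_map_id {e : H ⊗[K] H} (he : IsAveraging μ e)
    {υ : H →ₗ[K] Module.End K P} (hυ : IsAction μ υ) (f : M →ₗ[K] N) :
    sandwich (diagAct υ ρ) (diagAct υ τ) (map LinearMap.id f) e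
      = map LinearMap.id (sandwich ρ τ f e) := by
  ext p x
  have key : ∀ z : H ⊗[K] H, sandwich (diagAct υ ρ) (diagAct υ τ) (map LinearMap.id f) z (p ⊗ₜ x)
      = map (υ.flip p) ((sandwich ρ τ f).flip x) (LinearMap.rTensor (H ⊗[K] H) (lift μ.flip)
        (tensorTensorTensorComm K H H H H (map comul comul z))) := by
    intro z
    induction z with
    | zero => simp
    | add a b ha hb => simp only [map_add, LinearMap.add_apply, ha, hb]
    | tmul a b =>
      rw [sandwich_tmul, diagAct_tmul, map_tmul]
      generalize comul (R := K) a = s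
      induction s with
      | zero => simp
      | add a b ha hb => simp only [map_add, add_tmul, ha, hb]
      | tmul c d =>
        simp only [map_tmul, LinearMap.id_apply, diagAct_tmul]
        generalize comul (R := K) b = t
        induction t with
        | zero => simp
        | add a b ha hb => simp only [map_add, tmul_add, ha, hb]
        | tmul i j => simp [hυ.mul]
  simp [key, he.left, hυ.one]

lemma IsAveraging.sandwich_id_map {e : H ⊗[K] H} (he : IsAveraging μ e)
    {υ : H →ₗ[K] Module.End K P} (hυ : IsAction μ υ) (f : M →ₗ[K] N) :
    sandwich (diagAct ρ υ) (diagAct τ υ) (map f LinearMap.id) e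
      = map (sandwich ρ τ f e) LinearMap.id := by
  ext x p
  have key : ∀ z : H ⊗[K] H, sandwich (diagAct ρ υ) (diagAct τ υ) (map f LinearMap.id) z (x ⊗ₜ p)
      = map ((sandwich ρ τ f).flip x) (υ.flip p) (LinearMap.lTensor (H ⊗[K] H) (lift μ.flip)
        (tensorTensorTensorComm K H H H H (map comul comul z))) := by
    intro z
    induction z with
    | zero => simp
    | add a b ha hb => simp only [map_add, LinearMap.add_apply, ha, hb]
    | tmul a b =>
      rw [sandwich_tmul, diagAct_tmul, map_tmul]
      generalize comul (R := K) a = s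
      induction s with
      | zero => simp
      | add a b ha hb => simp only [map_add, add_tmul, ha, hb]
      | tmul c d =>
        simp only [map_tmul, LinearMap.id_apply, diagAct_tmul]
        generalize comul (R := K) b = t
        induction t with
        | zero => simp
        | add a b ha hb => simp only [map_add, tmul_add, ha, hb]
        | tmul i j => simp [hυ.mul]
  simp [key, he.right, hυ.one]

/-- The average of a smoothing coderivation is again one. -/
lemma IsSmoothing.sandwich {C : Type*} [AddCommGroup C] [Module K C] [Coalgebra K C]
    {τ : H →ₗ[K] Module.End K C} (hτ : IsActedCoalgebra τ)
    (hτa : IsAction μ τ) {e : H ⊗[K] H} (he : IsAveraging μ e)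
    {η : C ⊗[K] (C ⊗[K] C) →ₗ[K] C} (hη : IsSmoothing η) :
    IsSmoothing (sandwich (diagAct τ (diagAct τ τ)) τ η e) := by
  have hid : IsEquivariant τ τ (LinearMap.id : C →ₗ[K] C) := fun _ _ ↦ rfl
  have hL : IsEquivariant (diagAct τ (diagAct τ τ)) (diagAct τ (diagAct τ (diagAct τ τ)))
      (cofreeCoactL K C) :=
    isEquivariant_assoc.comp (hτ.comul.map fun _ _ ↦ rfl)
  have hR : IsEquivariant (diagAct τ (diagAct τ τ)) (diagAct (diagAct τ (diagAct τ τ)) τ)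
      (cofreeCoactR K C) :=
    isEquivariant_assoc_symm.comp (hid.map (isEquivariant_assoc_symm.comp (hid.map hτ.comul)))
  constructor
  -- The equivariant maps Δ and the two coactions pass through the average, and the idle tensor
  -- factors drop out.
  · rw [comp_sandwich hτ.comul, hη.coderivation, sandwich_add, ← sandwich_comp hL,
      ← sandwich_comp hR, he.sandwich_map_id hτa, he.sandwich_id_map hτa]
  -- The boundary of the average is the average of the boundary, and the right-hand side is
  -- equivariant, hence fixed by averaging.
  · have h1 : IsEquivariant (diagAct τ τ) (diagAct τ (diagAct τ τ))
        ((TensorProduct.assoc K C C C).toLinearMap ∘ₗ map comul LinearMap.id) :=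
      isEquivariant_assoc.comp (hτ.comul.map hid)
    have h2 : IsEquivariant (diagAct τ τ) (diagAct τ (diagAct τ τ))
        (map (LinearMap.id : C →ₗ[K] C) (comul (R := K) (A := C))) := hid.map hτ.comul
    have h3 : IsEquivariant (diagAct τ τ) τ
        ((TensorProduct.rid K C).toLinearMap ∘ₗ map LinearMap.id counit
          - (TensorProduct.lid K C).toLinearMap ∘ₗ map counit LinearMap.id) :=
      (isEquivariant_rid.comp (hid.map hτ.counit)).sub
        (isEquivariant_lid.comp (hτ.counit.map hid))
    rw [sandwich_comp h1, sandwich_comp h2, ← sandwich_sub, hη.boundary,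
      he.sandwich_of_isEquivariant hτa h3]

end Averaging

end Actions


/-! ### The separability element of an ad-coinvariant integral -/

section Integral

variable {K : Type u} {H : Type v} [Field K] [Ring H] [HopfAlgebra K H]

local notation "S" => HopfAlgebra.antipode K (A := H)

/-- The bracketing x₁ ⊗ Δ(x₂) ⊗ x₃ of the fourfold coproduct exposes the middle pair to the antipode
axiom. -/
lemma tconv_comul_comul {C : Type*} [AddCommGroup C] [Module K C] [Coalgebra K C] (x : C) :
    map comul comul (comul (R := K) x) = (TensorProduct.assoc K C C (C ⊗[K] C)).symm
      (map LinearMap.id (TensorProduct.assoc K C C C).toLinearMap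
        (tconv LinearMap.id (tconv comul LinearMap.id) x)) := by
  have h0 : (comul : C →ₗ[K] C ⊗[K] C) = tconv LinearMap.id LinearMap.id := by
    rw [tconv, map_id, LinearMap.id_comp]
  have h2 := assoc_comp_tconv (K := K) (E := C) LinearMap.id LinearMap.id
    (comul : C →ₗ[K] C ⊗[K] C)
  have h3 := assoc_comp_tconv (K := K) (E := C) LinearMap.id LinearMap.id LinearMap.id
  rw [← LinearMap.comp_apply (map _ _) (tconv _ _), map_comp_tconv, LinearMap.id_comp]
  rw [← h0] at h2 h3
  rw [h3, ← h2]
  simp [tconv]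

lemma tconv_id_tconv_comul (x : H) :
    tconv LinearMap.id (tconv (comul (R := K)) LinearMap.id) x
      = map LinearMap.id (map comul LinearMap.id)
        (tconv LinearMap.id (tconv LinearMap.id LinearMap.id) x) := by
  rw [← LinearMap.comp_apply (map _ _), map_comp_tconv, map_comp_tconv]
  rfl

lemma contract_middle (x : H) :
    map LinearMap.id ((TensorProduct.lid K H).toLinearMap ∘ₗ map counit LinearMap.id)
      (tconv LinearMap.id (tconv LinearMap.id LinearMap.id) x) = comul (R := K) x := by
  have h : (TensorProduct.lid K H).toLinearMap ∘ₗ map counit LinearMap.id ∘ₗ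
      tconv LinearMap.id LinearMap.id = LinearMap.id := by
    ext y
    have := Coalgebra.rTensor_counit_comul (R := K) y
    rw [LinearMap.rTensor_def] at this
    simp [tconv, this]
  rw [← LinearMap.comp_apply (map _ _), map_comp_tconv, LinearMap.comp_assoc, h,
    LinearMap.id_comp, tconv, map_id, LinearMap.id_comp]

/-- The antipode is anticomultiplicative. -/
lemma comul_comp_antipode : comul ∘ₗ S = map S S ∘ₗ (TensorProduct.comm K H H).toLinearMap ∘ₗ
    comul := by
  -- Both sides are convolution inverses of Δ in Hom(H, H ⊗ H). The left one holds because Δ is an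
  -- algebra map; the right one computes x₁S(x₄) ⊗ x₂S(x₃) by collapsing the middle pair first.
  have hA : toConv (comul ∘ₗ S) * toConv (comul (R := K) (A := H)) = 1 := by
    have := LinearMap.algHom_comp_convMul_distrib (Bialgebra.comulAlgHom K H) (toConv S)
      (toConv LinearMap.id)
    rw [LinearMap.antipode_mul_id] at this
    apply WithConv.ofConv_injective
    refine Eq.trans this.symm ?_
    ext x
    simp
  have hB : toConv (comul (R := K) (A := H)) * toConv (map S S ∘ₗ
      (TensorProduct.comm K H H).toLinearMap ∘ₗ comul) = 1 := by
    ext x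
    rw [LinearMap.convMul_apply, LinearMap.convOne_apply]
    let T : (H ⊗[K] H) ⊗[K] (H ⊗[K] H) →ₗ[K] H ⊗[K] H := LinearMap.mul' K (H ⊗[K] H) ∘ₗ
      map LinearMap.id (map S S ∘ₗ (TensorProduct.comm K H H).toLinearMap)
    have e1 : LinearMap.mul' K (H ⊗[K] H) (map comul (map S S ∘ₗ
        (TensorProduct.comm K H H).toLinearMap ∘ₗ comul) (comul (R := K) x))
        = T (map comul comul (comul (R := K) x)) := by
      simp only [T, LinearMap.comp_apply]
      rw [← LinearMap.comp_apply (map _ _) (map _ _), ← map_comp]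
      rfl
    have e2 : ∀ w : H ⊗[K] (H ⊗[K] H), T ((TensorProduct.assoc K H H (H ⊗[K] H)).symm
        (map LinearMap.id (TensorProduct.assoc K H H H).toLinearMap
          (map LinearMap.id (map comul LinearMap.id) w)))
        = LinearMap.mul' K H (LinearMap.lTensor H S (map LinearMap.id
          ((TensorProduct.lid K H).toLinearMap ∘ₗ map counit LinearMap.id) w)) ⊗ₜ[K] (1 : H) := by
      intro w
      induction w with
      | zero => simp
      | add a b ha hb => simp only [map_add, add_tmul, ha, hb]
      | tmul a w =>
        induction w with
        | zero => simp
        | add a b ha hb => simp only [map_add, tmul_add, add_tmul, ha, hb]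
        | tmul b d =>
          have h3 : ∀ z : H ⊗[K] H, T ((TensorProduct.assoc K H H (H ⊗[K] H)).symm
              (a ⊗ₜ TensorProduct.assoc K H H H (z ⊗ₜ d)))
              = (a * S d) ⊗ₜ LinearMap.mul' K H (LinearMap.lTensor H S z) := by
            intro z
            induction z with
            | zero => simp
            | add a b ha hb => simp only [map_add, tmul_add, add_tmul, ha, hb]
            | tmul b c => simp [T]
          simp [h3, Algebra.algebraMap_eq_smul_one, TensorProduct.smul_tmul']
    change LinearMap.mul' K (H ⊗[K] H) (map comul (map S S ∘ₗ
        (TensorProduct.comm K H H).toLinearMap ∘ₗ comul) (comul (R := K) x)) = _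
    rw [e1, tconv_comul_comul, tconv_id_tconv_comul, e2, contract_middle,
      HopfAlgebra.mul_antipode_lTensor_comul_apply]
    rfl
  exact toConv_injective (left_inv_eq_right_inv hA hB)

variable (K) in
/-- The element `t₁ ⊗ S(t₂)` attached to `t`. -/
def casimir (t : H) : H ⊗[K] H := LinearMap.lTensor H S (comul t)

lemma map_comul_comul_casimir (t : H) : map comul comul (casimir K t)
    = map LinearMap.id (map S S ∘ₗ (TensorProduct.comm K H H).toLinearMap)
      ((TensorProduct.assoc K H H (H ⊗[K] H)).symm
      (map LinearMap.id (TensorProduct.assoc K H H H).toLinearMap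
        (map LinearMap.id (map comul LinearMap.id)
          (tconv LinearMap.id (tconv LinearMap.id LinearMap.id) t)))) := by
  rw [← tconv_id_tconv_comul, ← tconv_comul_comul, casimir, LinearMap.lTensor_def,
    ← LinearMap.comp_apply (map _ _), ← LinearMap.comp_apply (map _ _), ← map_comp, ← map_comp,
    comul_comp_antipode]
  rfl

variable {t : H}

/-- From Δ(ht) = ε(h)Δ(t) one gets h₁t₁ ⊗ S(t₂)S(h₂) = ε(h) t₁ ⊗ S(t₂). Then ht₁ ⊗ S(t₂) = h₁t₁ ⊗
S(t₂)S(h₂)h₃ = t₁ ⊗ S(t₂)h. -/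
lemma IsAdCoinvariantIntegral.casimir_central (ht : IsAdCoinvariantIntegral K H t) (h : H) :
    (h ⊗ₜ[K] (1 : H)) * casimir K t = casimir K t * ((1 : H) ⊗ₜ[K] h) := by
  let e : H ⊗[K] H := casimir K t
  let Q (w : H ⊗[K] H) : H ⊗[K] H →ₗ[K] H ⊗[K] H := lift (LinearMap.mk₂ K
    (fun a b ↦ (a ⊗ₜ[K] (1 : H)) * w * ((1 : H) ⊗ₜ[K] S b))
    (fun a a' b ↦ by simp [add_tmul, add_mul])
    (fun c a b ↦ by simp [← smul_tmul'])
    (fun a b b' ↦ by simp [tmul_add, mul_add])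
    (fun c a b ↦ by simp))
  have hQ (w : H ⊗[K] H) (a b : H) :
      Q w (a ⊗ₜ b) = (a ⊗ₜ[K] (1 : H)) * w * ((1 : H) ⊗ₜ[K] S b) := rfl
  have hQmul : ∀ z w : H ⊗[K] H, LinearMap.lTensor H S (z * w) = Q (LinearMap.lTensor H S w) z := by
    intro z w
    induction z with
    | zero => simp
    | add a b ha hb => simp only [add_mul, map_add, ha, hb]
    | tmul a b =>
      rw [hQ]
      induction w with
      | zero => simp
      | add a b ha hb => simp only [add_mul, mul_add, map_add, ha, hb]
      | tmul c d => simp [HopfAlgebra.antipode_mul_antidistrib]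
  have hQe (x : H) : Q e (comul x) = counit (R := K) x • e := by
    rw [show e = LinearMap.lTensor H S (comul t) from rfl, ← hQmul, ← Bialgebra.comul_mul, ht.mul_left,
      map_smul, map_smul]
  -- Evaluated on the iterated coproduct of h, this gives the middle expression; the two bracketings
  -- h₁ ⊗ Δ(h₂) and Δ(h₁) ⊗ h₂ yield the two sides of the claim.
  let Θ : H ⊗[K] (H ⊗[K] H) →ₗ[K] H ⊗[K] H := lift (LinearMap.mk₂ K
    (fun a z ↦ (a ⊗ₜ[K] (1 : H)) * e * ((1 : H) ⊗ₜ[K] LinearMap.mul' K H (LinearMap.rTensor H S z)))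
    (fun a a' b ↦ by simp [add_tmul, add_mul])
    (fun c a b ↦ by simp [← smul_tmul'])
    (fun a b b' ↦ by simp [tmul_add, mul_add])
    (fun c a b ↦ by simp))
  have hΘ (a : H) (z : H ⊗[K] H) : Θ (a ⊗ₜ z) = (a ⊗ₜ[K] (1 : H)) * e *
    ((1 : H) ⊗ₜ[K] LinearMap.mul' K H (LinearMap.rTensor H S z)) := rfl
  have h1 : ∀ w : H ⊗[K] H, Θ (LinearMap.lTensor H comul w)
      = (TensorProduct.rid K H (LinearMap.lTensor H counit w) ⊗ₜ[K] (1 : H)) * e := by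
    intro w
    induction w with
    | zero => simp
    | add a b ha hb => simp only [map_add, add_tmul, add_mul, ha, hb]
    | tmul a b =>
      rw [LinearMap.lTensor_tmul, hΘ, HopfAlgebra.mul_antipode_rTensor_comul_apply,
        Algebra.algebraMap_eq_smul_one, tmul_smul, mul_smul_comm, ← Algebra.TensorProduct.one_def,
        mul_one]
      simp [← smul_tmul']
  have h2 : ∀ w : H ⊗[K] H, Θ (TensorProduct.assoc K H H H (LinearMap.rTensor H comul w))
      = e * ((1 : H) ⊗ₜ[K] TensorProduct.lid K H (LinearMap.rTensor H counit w)) := by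
    intro w
    induction w with
    | zero => simp
    | add a b ha hb => simp only [map_add, tmul_add, mul_add, ha, hb]
    | tmul a b =>
      have h3 : ∀ z : H ⊗[K] H, Θ (TensorProduct.assoc K H H H (z ⊗ₜ b))
          = Q e z * ((1 : H) ⊗ₜ[K] b) := by
        intro z
        induction z with
        | zero => simp
        | add a b ha hb => simp only [map_add, add_tmul, add_mul, ha, hb]
        | tmul c d => rw [assoc_tmul, hΘ, hQ, mul_assoc _ _ ((1 : H) ⊗ₜ[K] b)]; simp
      rw [LinearMap.rTensor_tmul, h3, hQe]
      simp
  have h3 := h1 (comul h)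
  rw [← Coalgebra.coassoc_apply, h2] at h3
  simpa using h3.symm

lemma IsAdCoinvariantIntegral.mul_casimir (ht : IsAdCoinvariantIntegral K H t) :
    LinearMap.mul' K H (casimir K t) = 1 := by
  rw [casimir, HopfAlgebra.mul_antipode_lTensor_comul_apply, ht.counit_eq_one, map_one]

/-- The left side is t₁S(t₄) ⊗ t₂ ⊗ S(t₃), the image of the adjoint coaction of t under x ↦ x₁ ⊗
S(x₂) in the second factor. This is the one place where coinvariance is invoked directly. -/
lemma IsAdCoinvariantIntegral.casimir_left (ht : IsAdCoinvariantIntegral K H t) :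
    LinearMap.rTensor (H ⊗[K] H) (LinearMap.mul' K H)
      (tensorTensorTensorComm K H H H H (map comul comul (casimir K t)))
    = 1 ⊗ₜ casimir K t := by
  have h1 : ∀ w : H ⊗[K] (H ⊗[K] H), LinearMap.rTensor (H ⊗[K] H) (LinearMap.mul' K H)
      (tensorTensorTensorComm K H H H H
      (map LinearMap.id (map S S ∘ₗ (TensorProduct.comm K H H).toLinearMap)
      ((TensorProduct.assoc K H H (H ⊗[K] H)).symm
      (map LinearMap.id (TensorProduct.assoc K H H H).toLinearMap
        (map LinearMap.id (map comul LinearMap.id) w)))))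
      = LinearMap.lTensor H (LinearMap.lTensor H S ∘ₗ comul)
        (LinearMap.rTensor H (LinearMap.mul' K H ∘ₗ LinearMap.lTensor H S)
          ((TensorProduct.assoc K H H H).symm
            (LinearMap.lTensor H (TensorProduct.comm K H H).toLinearMap w))) := by
    intro w
    induction w with
    | zero => simp
    | add a b ha hb => simp only [map_add, ha, hb]
    | tmul a w =>
      induction w with
      | zero => simp
      | add a b ha hb => simp only [map_add, tmul_add, ha, hb]
      | tmul b d =>
        simp only [map_tmul, LinearMap.id_apply, LinearEquiv.coe_coe, LinearMap.lTensor_tmul,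
          comm_tmul, assoc_symm_tmul, LinearMap.rTensor_tmul, LinearMap.comp_apply]
        generalize comul (R := K) b = z
        induction z with
        | zero => simp
        | add a b ha hb => simp only [map_add, add_tmul, tmul_add, ha, hb]
        | tmul i j => simp
  have h2 : LinearMap.rTensor H (LinearMap.mul' K H ∘ₗ LinearMap.lTensor H S)
          ((TensorProduct.assoc K H H H).symm
            (LinearMap.lTensor H (TensorProduct.comm K H H).toLinearMap
              (tconv LinearMap.id (tconv LinearMap.id LinearMap.id) t))) = adCoaction K H t := by
    have : tconv LinearMap.id (tconv LinearMap.id LinearMap.id) t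
        = LinearMap.lTensor H comul (comul (R := K) t) := by
      simp [tconv, LinearMap.lTensor_def]
    rw [this, ← LinearMap.comp_apply (LinearMap.lTensor H _), ← LinearMap.lTensor_comp]
    rfl
  rw [map_comul_comul_casimir, h1, h2, ht.coinvariant]
  rfl

/-- The left side is t₁ ⊗ S(t₄) ⊗ t₂S(t₃), and the antipode axiom collapses t₂S(t₃); no property of
t enters. -/
lemma casimir_right (t : H) :
    LinearMap.lTensor (H ⊗[K] H) (LinearMap.mul' K H)
      (tensorTensorTensorComm K H H H H (map comul comul (casimir K t)))
    = casimir K t ⊗ₜ 1 := by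
  have h1 : ∀ w : H ⊗[K] (H ⊗[K] H), LinearMap.lTensor (H ⊗[K] H) (LinearMap.mul' K H)
      (tensorTensorTensorComm K H H H H
      (map LinearMap.id (map S S ∘ₗ (TensorProduct.comm K H H).toLinearMap)
      ((TensorProduct.assoc K H H (H ⊗[K] H)).symm
      (map LinearMap.id (TensorProduct.assoc K H H H).toLinearMap
        (map LinearMap.id (map comul LinearMap.id) w)))))
      = LinearMap.lTensor H S (map LinearMap.id
          ((TensorProduct.lid K H).toLinearMap ∘ₗ map counit LinearMap.id) w) ⊗ₜ[K] (1 : H) := by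
    intro w
    induction w with
    | zero => simp
    | add a b ha hb => simp only [map_add, add_tmul, ha, hb]
    | tmul a w =>
      induction w with
      | zero => simp
      | add a b ha hb => simp only [map_add, tmul_add, add_tmul, ha, hb]
      | tmul b d =>
        have h3 : ∀ z : H ⊗[K] H, LinearMap.lTensor (H ⊗[K] H) (LinearMap.mul' K H)
            (tensorTensorTensorComm K H H H H
            (map LinearMap.id (map S S ∘ₗ (TensorProduct.comm K H H).toLinearMap)
            ((TensorProduct.assoc K H H (H ⊗[K] H)).symm
            (a ⊗ₜ TensorProduct.assoc K H H H (z ⊗ₜ d)))))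
            = (a ⊗ₜ S d) ⊗ₜ LinearMap.mul' K H (LinearMap.lTensor H S z) := by
          intro z
          induction z with
          | zero => simp
          | add a b ha hb => simp only [map_add, tmul_add, add_tmul, ha, hb]
          | tmul b c => simp
        simp only [map_tmul, LinearMap.id_apply, LinearEquiv.coe_coe, h3,
          HopfAlgebra.mul_antipode_lTensor_comul_apply]
        simp [Algebra.algebraMap_eq_smul_one, TensorProduct.smul_tmul']
  rw [map_comul_comul_casimir, h1, contract_middle]
  rfl

/-- The version for right modules, which are actions for the opposite multiplication. -/
lemma IsAdCoinvariantIntegral.isAveraging_flip (ht : IsAdCoinvariantIntegral K H t) :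
    IsAveraging (LinearMap.mul K H).flip (casimir K t) where
  central h := by
    have h1 : ∀ z : H ⊗[K] H, LinearMap.rTensor H ((LinearMap.mul K H).flip.flip h) z
        = (h ⊗ₜ[K] (1 : H)) * z := by
      intro z
      induction z with
      | zero => simp
      | add a b ha hb => simp only [map_add, mul_add, ha, hb]
      | tmul a b => simp
    have h2 : ∀ z : H ⊗[K] H, LinearMap.lTensor H ((LinearMap.mul K H).flip h) z
        = z * ((1 : H) ⊗ₜ[K] h) := by
      intro z
      induction z with
      | zero => simp
      | add a b ha hb => simp only [map_add, add_mul, ha, hb]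
      | tmul a b => simp
    rw [h1, h2, ht.casimir_central]
  unit := ht.mul_casimir
  left := ht.casimir_left
  right := casimir_right t

/-- The version for left modules: passing to the opposite multiplication is compensated by swapping
the legs of the element. -/
lemma IsAdCoinvariantIntegral.isAveraging (ht : IsAdCoinvariantIntegral K H t) :
    IsAveraging (LinearMap.mul K H) (TensorProduct.comm K H H (casimir K t)) where
  central h := by
    have h1 : ∀ z : H ⊗[K] H, LinearMap.rTensor H ((LinearMap.mul K H).flip h)
        (TensorProduct.comm K H H z) = TensorProduct.comm K H H (z * ((1 : H) ⊗ₜ[K] h)) := by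
      intro z
      induction z with
      | zero => simp
      | add a b ha hb => simp only [map_add, add_mul, ha, hb]
      | tmul a b => simp
    have h2 : ∀ z : H ⊗[K] H, LinearMap.lTensor H (LinearMap.mul K H h)
        (TensorProduct.comm K H H z) = TensorProduct.comm K H H ((h ⊗ₜ[K] (1 : H)) * z) := by
      intro z
      induction z with
      | zero => simp
      | add a b ha hb => simp only [map_add, mul_add, ha, hb]
      | tmul a b => simp
    rw [h1, h2, ht.casimir_central]
  unit := by
    rw [← ht.mul_casimir]
    generalize casimir K t = z
    induction z with
    | zero => simp
    | add a b ha hb => simp only [map_add, ha, hb]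
    | tmul a b => simp
  left := by
    have h := congrArg (LinearMap.lTensor H (TensorProduct.comm K H H).toLinearMap) ht.casimir_left
    rw [LinearMap.lTensor_tmul] at h
    refine Eq.trans ?_ h
    generalize casimir K t = z
    induction z with
    | zero => simp
    | add a b ha hb => simp only [map_add, ha, hb]
    | tmul a b =>
      simp only [comm_tmul, map_tmul]
      generalize comul (R := K) a = s
      generalize comul (R := K) b = r
      induction s with
      | zero => simp
      | add a b ha hb => simp only [map_add, tmul_add, add_tmul, ha, hb]
      | tmul a b =>
        induction r with
        | zero => simp
        | add a b ha hb => simp only [map_add, tmul_add, add_tmul, ha, hb]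
        | tmul c d => simp
  right := by
    have h := congrArg (LinearMap.rTensor H (TensorProduct.comm K H H).toLinearMap)
      (casimir_right (K := K) t)
    rw [LinearMap.rTensor_tmul] at h
    refine Eq.trans ?_ h
    generalize casimir K t = z
    induction z with
    | zero => simp
    | add a b ha hb => simp only [map_add, ha, hb]
    | tmul a b =>
      simp only [comm_tmul, map_tmul]
      generalize comul (R := K) a = s
      generalize comul (R := K) b = r
      induction s with
      | zero => simp
      | add a b ha hb => simp only [map_add, tmul_add, add_tmul, ha, hb]
      | tmul a b =>
        induction r with
        | zero => simp
        | add a b ha hb => simp only [map_add, tmul_add, add_tmul, ha, hb]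
        | tmul c d => simp

end Integral


/-! ### Linear retractions, linear smoothings and the splitting theorem -/

section Splitting

variable {K : Type u} {H : Type v} [Field K] [Ring H]

section Bialgebra

variable [HopfAlgebra K H]

lemma leftAct_apply {E : Type*} [AddCommGroup E] [Module K E] [Module H E] [IsScalarTower K H E]
    (h : H) (x : E) : leftAct K H E h x = h • x := rfl

lemma rightAct_apply {E : Type*} [AddCommGroup E] [Module K E] [Module Hᵐᵒᵖ E]
    [IsScalarTower K Hᵐᵒᵖ E] (h : H) (x : E) :
    rightAct K H E h x = MulOpposite.op h • x := rfl

lemma isComultiplicative_mul : IsComultiplicative (LinearMap.mul K H) where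
  comul a b := by
    rw [LinearMap.mul_apply', Bialgebra.comul_mul]
    generalize comul (R := K) a = s
    generalize comul (R := K) b = r
    induction s with
    | zero => simp
    | add a b ha hb => simp only [map_add, add_mul, LinearMap.add_apply, ha, hb]
    | tmul a b =>
      induction r with
      | zero => simp
      | add a b ha hb => simp only [map_add, mul_add, ha, hb]
      | tmul c d => simp
  counit a b := by simp

lemma isComultiplicative_mul_flip : IsComultiplicative (LinearMap.mul K H).flip where
  comul a b := by
    rw [LinearMap.flip_apply, LinearMap.mul_apply', Bialgebra.comul_mul]
    generalize comul (R := K) a = s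
    generalize comul (R := K) b = r
    induction s with
    | zero => simp
    | add a b ha hb => simp only [map_add, mul_add, LinearMap.add_apply, ha, hb]
    | tmul a b =>
      induction r with
      | zero => simp
      | add a b ha hb => simp only [map_add, add_mul, ha, hb]
      | tmul c d => simp
  counit a b := by simp [mul_comm]

lemma isAction_leftAct (E : Type*) [AddCommGroup E] [Module K E] [Module H E]
    [IsScalarTower K H E] : IsAction (LinearMap.mul K H) (leftAct K H E) where
  mul a b x := mul_smul a b x
  one x := one_smul H x

lemma isAction_rightAct (E : Type*) [AddCommGroup E] [Module K E] [Module Hᵐᵒᵖ E]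
    [IsScalarTower K Hᵐᵒᵖ E] : IsAction (LinearMap.mul K H).flip (rightAct K H E) where
  mul a b x := mul_smul (MulOpposite.op a) (MulOpposite.op b) x
  one x := one_smul Hᵐᵒᵖ x

lemma IsLeftModuleCoalgebra.isActedCoalgebra {E : Type*} [AddCommGroup E] [Module K E]
    [Coalgebra K E] [Module H E] [IsScalarTower K H E] (hE : IsLeftModuleCoalgebra K H E) :
    IsActedCoalgebra (leftAct K H E) :=
  ⟨hE.comul_act, hE.counit_act⟩

lemma IsRightModuleCoalgebra.isActedCoalgebra {E : Type*} [AddCommGroup E] [Module K E]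
    [Coalgebra K E] [Module Hᵐᵒᵖ E] [IsScalarTower K Hᵐᵒᵖ E]
    (hE : IsRightModuleCoalgebra K H E) : IsActedCoalgebra (rightAct K H E) :=
  ⟨hE.comul_act, fun h x ↦ (hE.counit_act h x).trans (mul_comm _ _)⟩

variable (K H) in
lemma isLeftModuleCoalgebra_self : IsLeftModuleCoalgebra K H H where
  comul_act h x := by
    rw [smul_eq_mul, Bialgebra.comul_mul, diagonal]
    simp only [LinearMap.comp_apply]
    generalize comul (R := K) h = s
    generalize comul (R := K) x = r
    induction s with
    | zero => simp
    | add a b ha hb => simp only [map_add, add_mul, LinearMap.add_apply, ha, hb]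
    | tmul a b =>
      induction r with
      | zero => simp
      | add a b ha hb => simp only [map_add, mul_add, ha, hb]
      | tmul c d => simp [leftAct_apply]
  counit_act h x := by simp

variable (K H) in
lemma isRightModuleCoalgebra_self : IsRightModuleCoalgebra K H H where
  comul_act h x := by
    rw [op_smul_eq_mul, Bialgebra.comul_mul, diagonal]
    simp only [LinearMap.comp_apply]
    generalize comul (R := K) h = s
    generalize comul (R := K) x = r
    induction s with
    | zero => simp
    | add a b ha hb => simp only [map_add, mul_add, LinearMap.add_apply, ha, hb]
    | tmul a b =>
      induction r with
      | zero => simp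
      | add a b ha hb => simp only [map_add, add_mul, ha, hb]
      | tmul c d => simp [rightAct_apply]
  counit_act h x := by simp

/-- A counital retraction averages to a counital retraction. -/
lemma sandwich_retraction {E : Type*} [AddCommGroup E] [Module K E] [Coalgebra K E]
    {μ : H →ₗ[K] H →ₗ[K] H} {e : H ⊗[K] H} (he : IsAveraging μ e) (hμ : IsComultiplicative μ)
    {ρ : H →ₗ[K] Module.End K E} {τ : H →ₗ[K] Module.End K H} (hρ : IsActedCoalgebra ρ)
    (hτ : IsActedCoalgebra τ) (hτa : IsAction μ τ) {ι : H →ₗ[K] E} (hι : IsEquivariant τ ρ ι)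
    {σ : E →ₗ[K] H} (hσ : counit ∘ₗ σ = (counit : E →ₗ[K] K)) (hσι : σ ∘ₗ ι = LinearMap.id) :
    counit ∘ₗ sandwich ρ τ σ e = (counit : E →ₗ[K] K) ∧
      sandwich ρ τ σ e ∘ₗ ι = LinearMap.id := by
  constructor
  -- The counit and the identity are equivariant, so the averages of ε = εσ and of id = σι are
  -- themselves.
  · rw [comp_sandwich hτ.counit, hσ]
    exact he.sandwich_of_isEquivariant (IsAction.triv hμ) hρ.counit
  · rw [sandwich_comp hι, hσι]
    exact he.sandwich_of_isEquivariant hτa fun _ _ ↦ rfl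

/-- The Newton limit of an equivariant map is equivariant. -/
lemma equivariant_of_eventually_eq_newton {E : Type*} [AddCommGroup E] [Module K E]
    [Coalgebra K E] {ρ : H →ₗ[K] Module.End K E} {τ : H →ₗ[K] Module.End K H}
    (hρ : IsActedCoalgebra ρ) (hτ : IsActedCoalgebra τ) {η : H ⊗[K] (H ⊗[K] H) →ₗ[K] H}
    (hη : IsEquivariant (diagAct τ (diagAct τ τ)) τ η) {σ : E →ₗ[K] H}
    (hσ : IsEquivariant ρ τ σ) {π : E →ₗc[K] H}
    (hπ : ∀ x, ∃ n, ∀ m ≥ n, ((newton η)^[m] σ) x = π x) (h : H) (x : E) :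
    π (ρ h x) = τ h (π x) := by
  have hs (n : ℕ) : IsEquivariant ρ τ ((newton η)^[n] σ) := by
    induction n with
    | zero => exact hσ
    | succ n ih => rw [Function.iterate_succ_apply']; exact hη.newton hρ hτ ih
  obtain ⟨n, hn⟩ := hπ x
  obtain ⟨m, hm⟩ := hπ (ρ h x)
  -- One iterate late enough to equal the limit both at x and at its translate.
  rw [← hm _ (le_max_right n m), ← hn _ (le_max_left n m)]
  exact hs _ h x

/-- A formally smooth Hopf algebra with an ad-coinvariant integral has a smoothing coderivation
that is left and right linear. -/
theorem exists_equivariant_isSmoothing {t : H} (ht : IsAdCoinvariantIntegral K H t)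
    (hfs : IsFormallySmooth K H) : ∃ η : H ⊗[K] (H ⊗[K] H) →ₗ[K] H, IsSmoothing η ∧
      IsEquivariant (diagAct (leftAct K H H) (diagAct (leftAct K H H) (leftAct K H H)))
        (leftAct K H H) η ∧
      IsEquivariant (diagAct (rightAct K H H) (diagAct (rightAct K H H) (rightAct K H H)))
        (rightAct K H H) η := by
  obtain ⟨η, hη⟩ := hfs.exists_isSmoothing
  have hl := (isLeftModuleCoalgebra_self K H).isActedCoalgebra
  have hr := (isRightModuleCoalgebra_self K H).isActedCoalgebra
  have hla := isAction_leftAct (K := K) (H := H) H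
  have hra := isAction_rightAct (K := K) (H := H) H
  have hcomm (a b x : H) : rightAct K H H a (leftAct K H H b x)
      = leftAct K H H b (rightAct K H H a x) := mul_assoc b x a
  -- Average on the left, then on the right. The second averaging does not destroy left linearity
  -- because the two actions commute.
  refine ⟨_, (hη.sandwich hl hla ht.isAveraging).sandwich hr hra ht.isAveraging_flip, ?_, ?_⟩
  · exact IsEquivariant.sandwich (diagAct_commute hcomm (diagAct_commute hcomm hcomm)) hcomm
      (ht.isAveraging.isEquivariant_sandwich (hla.diag isComultiplicative_mul
        (hla.diag isComultiplicative_mul hla)) hla _) _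
  · exact ht.isAveraging_flip.isEquivariant_sandwich (hra.diag isComultiplicative_mul_flip
        (hra.diag isComultiplicative_mul_flip hra)) hra _

/-- An injective coalgebra homomorphism from a bialgebra has a counital linear retraction. -/
lemma exists_counital_retraction {E : Type*} [AddCommGroup E] [Module K E] [Coalgebra K E]
    (ι : H →ₗc[K] E) (hι : Function.Injective ι) : ∃ σ : E →ₗ[K] H,
      counit ∘ₗ σ = (counit : E →ₗ[K] K) ∧ σ ∘ₗ ι.toLinearMap = LinearMap.id := by
  obtain ⟨r, hr⟩ := ι.toLinearMap.exists_leftInverse_of_injective (LinearMap.ker_eq_bot.mpr hι)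
  -- Adding (ε − εr)·1 repairs the counit since ε(1) = 1, and changes nothing on the image of ι,
  -- where εr already agrees with ε.
  refine ⟨r + LinearMap.toSpanSingleton K H 1 ∘ₗ (counit - counit ∘ₗ r), ?_, ?_⟩
  · ext x
    simp
  · rw [LinearMap.add_comp, hr, LinearMap.comp_assoc, LinearMap.sub_comp, ι.counit_comp,
      LinearMap.comp_assoc, hr, LinearMap.comp_id, sub_self, LinearMap.comp_zero, add_zero]

end Bialgebra

end Splitting

end HopfSplitting

end

theorem mainTheorem6 (K : Type u) (H : Type v) [Field K] [Ring H] [HopfAlgebra K H]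
    (hint : ∃ t : H, HopfSplitting.IsAdCoinvariantIntegral K H t)
    (hfs : HopfSplitting.IsFormallySmooth K H) :
    (∀ (E : Type w) [AddCommGroup E] [Module K E] [Coalgebra K E]
      [Module Hᵐᵒᵖ E] [IsScalarTower K Hᵐᵒᵖ E],
      HopfSplitting.IsRightModuleCoalgebra K H E →
      ∀ ι : H →ₗc[K] E, Function.Injective ι →
        (∀ h x : H, ι (x * h) = MulOpposite.op h • ι x) →
        HopfSplitting.coradical K E ≤ LinearMap.range ι.toLinearMap →
        ∃ π : E →ₗc[K] H,
          (∀ (h : H) (x : E), π (MulOpposite.op h • x) = π x * h) ∧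
          ∀ x : H, π (ι x) = x) ∧
    (∀ (E : Type w) [AddCommGroup E] [Module K E] [Coalgebra K E]
      [Module H E] [IsScalarTower K H E] [Module Hᵐᵒᵖ E] [IsScalarTower K Hᵐᵒᵖ E]
      [SMulCommClass H Hᵐᵒᵖ E],
      HopfSplitting.IsBimoduleCoalgebra K H E →
      ∀ ι : H →ₗc[K] E, Function.Injective ι →
        (∀ h x : H, ι (h * x) = h • ι x) →
        (∀ h x : H, ι (x * h) = MulOpposite.op h • ι x) →
        HopfSplitting.coradical K E ≤ LinearMap.range ι.toLinearMap →
        ∃ π : E →ₗc[K] H,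
          (∀ (h : H) (x : E), π (h • x) = h * π x) ∧
          (∀ (h : H) (x : E), π (MulOpposite.op h • x) = π x * h) ∧
          ∀ x : H, π (ι x) = x) := by
  obtain ⟨t, ht⟩ := hint
  obtain ⟨η, hη, hηl, hηr⟩ := HopfSplitting.exists_equivariant_isSmoothing ht hfs
  have hl := (HopfSplitting.isLeftModuleCoalgebra_self K H).isActedCoalgebra
  have hr := (HopfSplitting.isRightModuleCoalgebra_self K H).isActedCoalgebra
  have hla := HopfSplitting.isAction_leftAct (K := K) (H := H) H
  have hra := HopfSplitting.isAction_rightAct (K := K) (H := H) H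
  constructor
  · intro E _ _ _ _ _ hE ι hι hιr hcorad
    obtain ⟨σ, hσ, hσι⟩ := HopfSplitting.exists_counital_retraction ι hι
    have hEr := hE.isActedCoalgebra
    -- The iteration starts from the averaged retraction, so that every iterate is right linear.
    obtain ⟨hσ', hσι'⟩ := HopfSplitting.sandwich_retraction ht.isAveraging_flip
      HopfSplitting.isComultiplicative_mul_flip hEr hr hra (ι := ι.toLinearMap) hιr hσ hσι
    obtain ⟨π, hπι, hπ⟩ := HopfSplitting.exists_coalgHom_eventually_eq_newton hη ι hcorad _ hσ'
      (LinearMap.congr_fun hσι')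
    exact ⟨π, HopfSplitting.equivariant_of_eventually_eq_newton hEr hr hηr
      (ht.isAveraging_flip.isEquivariant_sandwich
        (HopfSplitting.isAction_rightAct E) hra σ) hπ, hπι⟩
  · intro E _ _ _ _ _ _ _ _ hE ι hι hιl hιr hcorad
    obtain ⟨σ, hσ, hσι⟩ := HopfSplitting.exists_counital_retraction ι hι
    have hEl := hE.left.isActedCoalgebra
    have hEr := hE.right.isActedCoalgebra
    obtain ⟨hσ₁, hσι₁⟩ := HopfSplitting.sandwich_retraction ht.isAveraging
      HopfSplitting.isComultiplicative_mul hEl hl hla (ι := ι.toLinearMap) hιl hσ hσι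
    obtain ⟨hσ₂, hσι₂⟩ := HopfSplitting.sandwich_retraction ht.isAveraging_flip
      HopfSplitting.isComultiplicative_mul_flip hEr hr hra (ι := ι.toLinearMap) hιr hσ₁ hσι₁
    obtain ⟨π, hπι, hπ⟩ := HopfSplitting.exists_coalgHom_eventually_eq_newton hη ι hcorad _ hσ₂
      (LinearMap.congr_fun hσι₂)
    refine ⟨π, HopfSplitting.equivariant_of_eventually_eq_newton hEl hl hηl ?_ hπ,
      HopfSplitting.equivariant_of_eventually_eq_newton hEr hr hηr
        (ht.isAveraging_flip.isEquivariant_sandwich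
        (HopfSplitting.isAction_rightAct E) hra _) hπ, hπι⟩
    -- Left linearity of the starting map survives its right averaging because the bimodule actions
    -- on E and on H commute.
    exact HopfSplitting.IsEquivariant.sandwich (fun a b x ↦ (smul_comm b (MulOpposite.op a) x).symm)
      (fun a b x ↦ mul_assoc b x a)
      (ht.isAveraging.isEquivariant_sandwich (HopfSplitting.isAction_leftAct E) hla σ) _
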